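/- Let $M\ge 0$ be an integer, $c\in\mathbb R\setminus\{0\}$, $\kappa\in\mathbb C$, and let $\bar u=(u_1,\dots,u_M)$, $\bar v=(v_1,\dots,v_M)\in\mathbb R^M$ be two sets of real rapidities such that the $u_i$ are pairwise distinct, the $v_i$ are pairwise distinct, and $u_i\neq v_j$ for all $i,j$. Put $$g(x,y)=\frac{ic}{x-y},\quad f(x,y)=1+g(x,y),\quad h(x,y)=\frac{f(x,y)}{g(x,y)}=\frac{x-y+ic}{ic},\quad t(x,y)=\frac{g(x,y)}{h(x,y)}=\frac{(ic)^2}{(x-y)(x-y+ic)},$$ where for $h$ the last expression is used also when $x=y$, and write $h(x,\bar w)=\prod_k h(x,w_k)$, $h(\bar w,x)=\prod_k h(w_k,x)$. For $\bar w\in\mathbb R^M$ with distinct entries let $F(\bar w)=\prod_{i<j}f(w_i,w_j)$, and for $P\in S_M$ let $(\bar P\bar w)_i=w_{P^{-1}i}$. On $D=\{\bar x\in\mathbb R^M: x_1<\dots<x_M\}$ the coordinate Bethe wave function of the $\delta$-Bose gas on the infinite line is $$\psi_{\bar w}(\bar x)=\sum_{P\in S_M}F(\bar P\bar w)\,e^{i\sum_k(\bar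 P\bar w)_kx_k},$$ and the Bethe state is $|\psi(\bar w)\rangle=c^{M/2}\int_D d\bar x\,\psi_{\bar w}(\bar x)\,|\bar x\rangle$. The dual state is $\langle\psi(\bar w)|=c^{M/2}\int_D d\bar x\,\overline{\psi_{\bar w}(\bar x)}\,\langle\bar x|$, with the same constant $c^{M/2}$, so that the two constants multiply to $c^M$ (for $c>0$ it is the Hermitian conjugate of $|\psi(\bar w)\rangle$). Let $\mathcal O_\kappa$ be the operator of multiplication by $\prod_{i}\kappa^{\theta(-x_i)}$, i.e. by $\kappa^{\#\{i:\,x_i<0\}}$ (with $0^0=1$). The matrix element of $\mathcal O_\kappa$, an oscillatory integral over $D$, is understood in the sense of Abel: $$\langle\psi(\bar u)|\mathcal O_\kappa|\psi(\bar v)\rangle:=\lim_{\varepsilon\to0^+}c^M\int_D e^{-\varepsilon\sum_i|x_i|}\;\overline{\psi_{\bar u}(\bar x)}\;\kappa^{\#\{i:\,x_i<0\}}\;\psi_{\bar v}(\bar x)\,d\bar x .$$ Then the integral on the right converges absolutely for every $\varepsilon>0$, the limit exists, $\det_{i,j}[h^{-1}(u_i,v_j)]\neq0$, and $$\langle\psi(\bar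 u)|\mathcal O_\kappa|\psi(\bar v)\rangle=\textrm{det}_{i,j}^{-1}\big[h^{-1}(u_i,v_j)\big]\;\det_{i,j}\left[t(v_i,u_j)\,\frac{h(v_i,\bar u)}{h(\bar u,v_i)}\,\frac{h(\bar v,v_i)}{h(v_i,\bar v)}+\kappa\,t(u_j,v_i)\right]$$ $$=\textrm{det}_{i,j}^{-1}\left[\frac{ic}{u_i-v_j+ic}\right]\det_{i,j}\left[\frac{(ic)^2}{(v_i-u_j)(v_i-u_j+ic)}\prod_{k=1}^M\frac{v_i-u_k+ic}{v_i-u_k-ic}\prod_{k=1}^M\frac{v_i-v_k-ic}{v_i-v_k+ic}+\kappa\,\frac{(ic)^2}{(v_i-u_j)(v_i-u_j-ic)}\right].$$ -/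

import Mathlib

open Filter Topology MeasureTheory

noncomputable section

namespace DeltaBose

/-! ### The rational functions -/

/-- `g(x,y) = ic / (x - y)`. -/
def g (c : ℝ) (x y : ℂ) : ℂ := Complex.I * c / (x - y)

/-- `f(x,y) = 1 + g(x,y)`. -/
def f (c : ℝ) (x y : ℂ) : ℂ := 1 + g c x y

/-- `h(x,y) = (x - y + ic) / (ic)`; it equals `f / g` wherever `x ≠ y`. -/
def h (c : ℝ) (x y : ℂ) : ℂ := (x - y + Complex.I * c) / (Complex.I * c)

/-- `t(x,y) = g(x,y) / h(x,y)`. -/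
def t (c : ℝ) (x y : ℂ) : ℂ := g c x y / h c x y

theorem h_eq_f_div_g {c : ℝ} (hc : c ≠ 0) {x y : ℂ} (hxy : x ≠ y) :
    h c x y = f c x y / g c x y := by
  have h1 : x - y ≠ 0 := sub_ne_zero.mpr hxy
  have h2 : (c : ℂ) ≠ 0 := by exact_mod_cast hc
  have h3 := Complex.I_ne_zero
  unfold h f g
  field_simp

/-! ### Bethe wave functions -/

/-- `F(w) = ∏_{i<j} f(w_i, w_j)`. -/
def F {M : ℕ} (c : ℝ) (w : Fin M → ℝ) : ℂ :=
  ∏ i : Fin M, ∏ j ∈ Finset.Ioi i, f c (w i) (w j)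

/-- The permuted tuple, `(P w)_i = w_{P⁻¹ i}`. -/
def permute {M : ℕ} (P : Equiv.Perm (Fin M)) (w : Fin M → ℝ) : Fin M → ℝ :=
  fun i => w (P⁻¹ i)

/-- The fundamental domain `D = {x | x_1 < x_2 < ⋯ < x_M}`. -/
def D (M : ℕ) : Set (Fin M → ℝ) := {x | ∀ i j, i < j → x i < x j}

/-- The Bethe superposition of plane waves on `D`, without normalization:
`∑_P F(P w) exp(i (P w, x))`. -/
def betheSum {M : ℕ} (c : ℝ) (w x : Fin M → ℝ) : ℂ :=
  ∑ P : Equiv.Perm (Fin M),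
    F c (permute P w) * Complex.exp (Complex.I * ((∑ i, permute P w i * x i : ℝ) : ℂ))

/-- The normalization constant `c^{M/2}` (principal branch if `c < 0`). -/
def normConst (c : ℝ) (M : ℕ) : ℂ := (c : ℂ) ^ ((M : ℂ) / 2)

/-- The components `⟨x|ψ(w)⟩`, `x ∈ D`, of the Bethe state. -/
def betheKet {M : ℕ} (c : ℝ) (w x : Fin M → ℝ) : ℂ :=
  normConst c M * betheSum c w x

/-- The components `⟨ψ(w)|x⟩`, `x ∈ D`, of the dual Bethe state. The wave function is
complex conjugated and the normalization constant is `c^{M/2}` again, so that the two constants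
multiply to `c^M` whatever the sign of `c`. For `c ≥ 0` this is the complex conjugate of
`betheKet`, see `betheBra_eq_conj`. -/
def betheBra {M : ℕ} (c : ℝ) (w x : Fin M → ℝ) : ℂ :=
  normConst c M * (starRingEnd ℂ) (betheSum c w x)

theorem normConst_mul_self {c : ℝ} (hc : c ≠ 0) (M : ℕ) :
    normConst c M * normConst c M = (c : ℂ) ^ M := by
  have h2 : (c : ℂ) ≠ 0 := by exact_mod_cast hc
  unfold normConst
  rw [← Complex.cpow_add _ _ h2, add_halves, Complex.cpow_natCast]

theorem betheBra_eq_conj {M : ℕ} {c : ℝ} (hc : 0 ≤ c) (w x : Fin M → ℝ) :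
    betheBra c w x = (starRingEnd ℂ) (betheKet c w x) := by
  have h1 : normConst c M = ((c ^ ((M : ℝ) / 2) : ℝ) : ℂ) := by
    unfold normConst
    rw [Complex.ofReal_cpow hc]
    push_cast
    rfl
  unfold betheBra betheKet
  rw [map_mul, h1, Complex.conj_ofReal]

/-! ### The particle number operator and its matrix elements -/

/-- The Heaviside function (the value at `0` concerns a null set only). -/
def heaviside (s : ℝ) : ℕ := if 0 < s then 1 else 0

/-- The multiplication operator `O_κ = ∏_i κ^{θ(-x_i)}`. -/
def numberOp {M : ℕ} (κ : ℂ) (ψ : (Fin M → ℝ) → ℂ) : (Fin M → ℝ) → ℂ :=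
  fun x => (∏ i, κ ^ heaviside (-(x i))) * ψ x

/-- The integrand `⟨ψ(u)|x⟩ ⟨x|O_κ|ψ(v)⟩` of the matrix element, multiplied by the convergence
factor `exp(-ε ∑_i |x_i|)`. -/
def mepnoIntegrand {M : ℕ} (c : ℝ) (κ : ℂ) (u v : Fin M → ℝ) (ε : ℝ) (x : Fin M → ℝ) : ℂ :=
  (Real.exp (-ε * ∑ i, |x i|) : ℂ) * (betheBra c u x * numberOp κ (betheKet c v) x)

/-- `⟨ψ(u)|O_κ|ψ(v)⟩ = S`. The wave functions are bounded and do not decay, so the integral over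
`D` is an oscillatory one; it is understood in the sense of Abel, that is, with the
`i0`-prescription: the integrals with convergence factor converge absolutely for all `ε > 0`,
and they tend to `S` as `ε → 0+`. -/
def HasMatrixElement {M : ℕ} (c : ℝ) (κ : ℂ) (u v : Fin M → ℝ) (S : ℂ) : Prop :=
  (∀ ε : ℝ, 0 < ε → IntegrableOn (mepnoIntegrand c κ u v ε) (D M)) ∧
  Tendsto (fun ε : ℝ => ∫ x in D M, mepnoIntegrand c κ u v ε x) (𝓝[>] 0) (𝓝 S)

/-! ### The two determinants -/

/-- The matrix `[h⁻¹(u_i, v_j)]`. -/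
def cauchyMatrix {M : ℕ} (c : ℝ) (u v : Fin M → ℝ) : Matrix (Fin M) (Fin M) ℂ :=
  Matrix.of fun i j => (h c (u i) (v j))⁻¹

/-- The matrix
`[t(v_i,u_j) (h(v_i,ū) / h(ū,v_i)) (h(v̄,v_i) / h(v_i,v̄)) + κ t(u_j,v_i)]`, where a tuple as an
argument stands for the product over its elements. -/
def slavnovMatrix {M : ℕ} (c : ℝ) (κ : ℂ) (u v : Fin M → ℝ) : Matrix (Fin M) (Fin M) ℂ :=
  Matrix.of fun i j =>
    t c (v i) (u j)
      * ((∏ k, h c (v i) (u k)) / ∏ k, h c (u k) (v i))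
      * ((∏ k, h c (v k) (v i)) / ∏ k, h c (v i) (v k))
    + κ * t c (u j) (v i)

end DeltaBose

end

/-!
With `η = ic` and the Vandermonde denominators of the amplitudes pulled out, the matrix element is
a double sum over permutations of exponential integrals. The domain `D` splits, up to a null set,
into the sectors with `n` negative and `M - n` positive coordinates. On such a sector the
convergence factor shifts the `v i` in the exponents by `-iε` on the negative and by `iε` on the
positive half-line, while the amplitudes depend on differences only.

*Half-lines.* Integrating plane waves over `0 < x_1 < ⋯ < x_n` gives products of inverse partial
sums of the `v i - u j`. Individual terms may be singular as `ε → 0`, but the sum over the orderings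
is `∏ (v i - u j + η)` times the determinant of the kernel `1 / ((v i - u j) (v i - u j + η))`
(`sectorSum_eq`), which is regular because `u i ≠ v j`. This is proved by splitting off one
particle: the recursion becomes a bilinear form in the adjugate of the kernel matrix
(`sum_adjugate_kern`), and by partial fractions the two vectors in it are images of residue vectors
under that matrix and its transpose.

*Partitions.* Hence the limit is a sum over the sets of `u i` and of `v i` that sit on the negative
half-line. For a fixed set of `v i`, the sum over the sets of `u i` is a single determinant
(`sum_split_eq_join`). As functions of one of the `v i` in the negative group, both sides of this
identity are, after clearing denominators, polynomials of degree at most `2M - 2`; they agree at the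
`M` points `u k` by induction, and at the other `M - 1` values of the (shifted) `v k` because both
sides vanish there.

*Resummation.* The remaining sum over the sets of `v i`, with weight `κ ^ n`, is the expansion
along rows of the determinant of a sum of two matrices (`sum_pow_mul_subsetTerm`), namely of the
second matrix in the statement. The prefactor is the inverse of a Cauchy determinant
(`det_cauchy`).
-/

namespace DeltaBose

open Finset Equiv

/-! ### Permutations, products over pairs and partial fractions -/

/-- The permutation `0 ↦ a`, `i + 1 ↦ a.succAbove (σ i)`. -/
def consPerm {n : ℕ} (a : Fin (n + 1)) (σ : Perm (Fin n)) : Perm (Fin (n + 1)) :=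
  (a.cycleRange.symm : Perm (Fin (n + 1))) * Perm.decomposeFin.symm (0, σ)

theorem consPerm_zero {n : ℕ} (a : Fin (n + 1)) (σ : Perm (Fin n)) : consPerm a σ 0 = a := by
  simp [consPerm]

theorem consPerm_succ {n : ℕ} (a : Fin (n + 1)) (σ : Perm (Fin n)) (i : Fin n) :
    consPerm a σ i.succ = a.succAbove (σ i) := by
  simp [consPerm]

theorem sign_consPerm {n : ℕ} (a : Fin (n + 1)) (σ : Perm (Fin n)) :
    ((Perm.sign (consPerm a σ) : ℤ) : ℂ) = (-1) ^ (a : ℕ) * ((Perm.sign σ : ℤ) : ℂ) := by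
  simp [consPerm]

/-- Expansion of a sum over permutations according to the image of `0`. -/
theorem sum_perm_fin_succ {n : ℕ} (φ : Perm (Fin (n + 1)) → ℂ) :
    ∑ σ, φ σ = ∑ a, ∑ σ, φ (consPerm a σ) := by
  rw [← Fintype.sum_prod_type' (f := fun a σ => φ (consPerm a σ))]
  symm
  refine Fintype.sum_bijective (fun x : Fin (n + 1) × Perm (Fin n) => consPerm x.1 x.2) ?_ _ _
    fun _ => rfl
  rw [Fintype.bijective_iff_injective_and_card]
  constructor
  · rintro ⟨a, σ⟩ ⟨b, τ⟩ h
    have h' : consPerm a σ = consPerm b τ := h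
    have hab : a = b := by simpa [consPerm_zero] using congrArg (fun p => p 0) h'
    subst hab
    refine Prod.ext rfl (Equiv.ext fun i => ?_)
    have := congrArg (fun p => p i.succ) h'
    simpa [consPerm_succ] using this
  · simp [Fintype.card_perm, Nat.factorial_succ]

/-- The product of `φ (w i) (w j)` over all `i < j`. -/
noncomputable def pairProd {n : ℕ} (φ : ℂ → ℂ → ℂ) (w : Fin n → ℂ) : ℂ :=
  ∏ i, ∏ j, if i < j then φ (w i) (w j) else 1

theorem pairProd_succ {n : ℕ} (φ : ℂ → ℂ → ℂ) (w : Fin (n + 1) → ℂ) :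
    pairProd φ w = (∏ i : Fin n, φ (w 0) (w i.succ)) * pairProd φ (w ∘ Fin.succ) := by
  simp [pairProd, Fin.prod_univ_succ]

theorem pairProd_rev {n : ℕ} (φ : ℂ → ℂ → ℂ) (w : Fin n → ℂ) :
    pairProd φ (w ∘ Fin.rev) = pairProd (fun x y => φ y x) w := by
  unfold pairProd
  rw [Finset.prod_comm]
  refine Fintype.prod_equiv Fin.revPerm _ _ fun i => Fintype.prod_equiv Fin.revPerm _ _ fun j => ?_
  simp

theorem pairProd_add {n m : ℕ} (φ : ℂ → ℂ → ℂ) (w : Fin (n + m) → ℂ) :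
    pairProd φ w = pairProd φ (w ∘ Fin.castAdd m) * pairProd φ (w ∘ Fin.natAdd n) *
      ∏ i : Fin n, ∏ j : Fin m, φ (w (Fin.castAdd m i)) (w (Fin.natAdd n j)) := by
  have h1 : ∀ (i : Fin n) (j : Fin m), Fin.castAdd m i < Fin.natAdd n j := fun i j => by
    rw [Fin.lt_def]; simp; omega
  have h2 : ∀ (i : Fin n) (j : Fin m), ¬ Fin.natAdd n j < Fin.castAdd m i := fun i j =>
    not_lt.2 (h1 i j).le
  simp only [pairProd, Fin.prod_univ_add, h1, h2, if_true, if_false, prod_mul_distrib,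
    Function.comp]
  have h3 : ∀ i j : Fin n, Fin.castAdd m i < Fin.castAdd m j ↔ i < j := fun i j => Iff.rfl
  have h4 : ∀ i j : Fin m, Fin.natAdd n i < Fin.natAdd n j ↔ i < j := fun i j => by
    rw [Fin.lt_def, Fin.lt_def]; simp
  simp only [h3, h4, prod_const_one]
  ring

theorem pairProd_div {n : ℕ} (φ χ : ℂ → ℂ → ℂ) (w : Fin n → ℂ) :
    pairProd (fun x y => φ x y / χ x y) w = pairProd φ w / pairProd χ w := by
  unfold pairProd
  simp only [← prod_div_distrib]
  refine prod_congr rfl fun i _ => prod_congr rfl fun j _ => ?_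
  split_ifs <;> simp

theorem pairProd_eq_Ioi {n : ℕ} (φ : ℂ → ℂ → ℂ) (w : Fin n → ℂ) :
    pairProd φ w = ∏ i, ∏ j ∈ Ioi i, φ (w i) (w j) := by
  unfold pairProd
  refine prod_congr rfl fun i _ => ?_
  rw [← prod_filter]
  congr 1
  ext; simp

theorem pairProd_sub_eq_det_vandermonde {n : ℕ} (w : Fin n → ℂ) :
    pairProd (fun x y => y - x) w = (Matrix.vandermonde w).det := by
  rw [pairProd_eq_Ioi, Matrix.det_vandermonde]

theorem pairProd_sub_ne_zero {n : ℕ} {w : Fin n → ℂ} (hw : Function.Injective w) :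
    pairProd (fun x y => y - x) w ≠ 0 := by
  rw [pairProd_sub_eq_det_vandermonde]
  exact Matrix.det_vandermonde_ne_zero_iff.2 hw

theorem pairProd_sub_perm {n : ℕ} (w : Fin n → ℂ) (σ : Perm (Fin n)) :
    pairProd (fun x y => y - x) (w ∘ σ) =
      ((Perm.sign σ : ℤ) : ℂ) * pairProd (fun x y => y - x) w := by
  rw [pairProd_sub_eq_det_vandermonde, pairProd_sub_eq_det_vandermonde, ← Matrix.det_permute]
  rfl

/-- The diagonal of the product of the two orientations of the Vandermonde product: it is the
determinant of the Lagrange numerators at their own nodes. -/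
theorem pairProd_sub_mul_pairProd_sub {n : ℕ} (w : Fin n → ℂ) :
    pairProd (fun x y => y - x) w * pairProd (fun x y => x - y) w =
      ∏ i, ∏ k ∈ univ.erase i, (w i - w k) := by
  have h : pairProd (fun x y => y - x) w = ∏ i, ∏ j, if j < i then w i - w j else 1 := by
    unfold pairProd
    rw [Finset.prod_comm]
  rw [h, pairProd, ← prod_mul_distrib]
  refine prod_congr rfl fun i _ => ?_
  rw [← prod_mul_distrib, ← mul_prod_erase univ _ (mem_univ i)]
  simp only [lt_irrefl, if_false, one_mul]
  refine prod_congr rfl fun j hj => ?_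
  rcases lt_trichotomy i j with hij | hij | hij
  · simp [hij, hij.not_gt]
  · simp [hij] at hj
  · simp [hij, hij.not_gt]

theorem pairProd_sub_rev {n : ℕ} (w : Fin n → ℂ) (σ : Perm (Fin n)) :
    pairProd (fun x y => x - y) (w ∘ σ) =
      ((Perm.sign σ : ℤ) : ℂ) * pairProd (fun x y => x - y) w := by
  have h : ∀ w : Fin n → ℂ, pairProd (fun x y => x - y) w =
      pairProd (fun x y => y - x) (fun i => - w i) := fun w => by
    unfold pairProd
    refine prod_congr rfl fun i _ => prod_congr rfl fun j _ => ?_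
    congr 1; ring
  rw [h, h]
  exact pairProd_sub_perm (fun i => - w i) σ

theorem pairProd_sub_rev_ne_zero {n : ℕ} {w : Fin n → ℂ} (hw : Function.Injective w) :
    pairProd (fun x y => x - y) w ≠ 0 := by
  refine right_ne_zero_of_mul (a := pairProd (fun x y => y - x) w) ?_
  rw [pairProd_sub_mul_pairProd_sub]
  refine prod_ne_zero_iff.2 fun i _ => prod_ne_zero_iff.2 fun k hk => sub_ne_zero.2 fun h => ?_
  exact (mem_erase.1 hk).1 (hw h).symm

/-- The Cauchy determinant. -/
theorem det_cauchy {n : ℕ} (x y : Fin n → ℂ) (hy : Function.Injective y)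
    (hxy : ∀ i j, x i - y j ≠ 0) :
    (Matrix.of fun i j => (x i - y j)⁻¹).det * ∏ i, ∏ j, (x i - y j) =
      pairProd (fun a b => b - a) x * pairProd (fun a b => a - b) y := by
  classical
  -- the numerators `∏_{k ≠ j} (X - y_k)`, expanded in powers of `X`
  let p : Fin n → Polynomial ℂ := fun j => ∏ k ∈ univ.erase j, (Polynomial.X - Polynomial.C (y k))
  let Cf : Matrix (Fin n) (Fin n) ℂ := Matrix.of fun k j => (p j).coeff k
  have hdeg : ∀ j, (p j).natDegree < n := fun j => by
    have : (p j).natDegree = n - 1 := by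
      simp [p, Polynomial.natDegree_prod_of_monic, Polynomial.monic_X_sub_C]
    have := j.pos
    omega
  have hmul : ∀ z : Fin n → ℂ, Matrix.vandermonde z * Cf =
      Matrix.of fun i j => ∏ k ∈ univ.erase j, (z i - y k) := fun z => by
    ext i j
    have : (p j).eval (z i) = ∏ k ∈ univ.erase j, (z i - y k) := by
      simp [p, Polynomial.eval_prod]
    rw [Matrix.of_apply, ← this, Polynomial.eval_eq_sum_range' (hdeg j), Matrix.mul_apply,
      ← Fin.sum_univ_eq_sum_range (fun k => (p j).coeff k * z i ^ k)]
    exact sum_congr rfl fun k _ => by simp [Cf, Matrix.vandermonde_apply, mul_comm]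
  have hx : (Matrix.of fun i j => (x i - y j)⁻¹).det * ∏ i, ∏ j, (x i - y j) =
      (Matrix.vandermonde x).det * Cf.det := by
    rw [← Matrix.det_mul, hmul, mul_comm, ← Matrix.det_mul_column]
    congr 1
    ext i j
    rw [Matrix.of_apply, Matrix.of_apply, Matrix.of_apply, ← mul_prod_erase univ _ (mem_univ j)]
    field_simp [hxy i j]
  have hyy : (Matrix.vandermonde y).det * Cf.det = ∏ i, ∏ k ∈ univ.erase i, (y i - y k) := by
    rw [← Matrix.det_mul, hmul, ← Matrix.det_diagonal]
    congr 1
    ext i j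
    by_cases h : i = j
    · subst h; simp
    · rw [Matrix.diagonal_apply_ne _ h, Matrix.of_apply]
      exact prod_eq_zero (mem_erase.2 ⟨h, mem_univ _⟩) (sub_self _)
  rw [← pairProd_sub_mul_pairProd_sub, ← pairProd_sub_eq_det_vandermonde] at hyy
  rw [hx, mul_left_cancel₀ (pairProd_sub_ne_zero hy) hyy, pairProd_sub_eq_det_vandermonde]

/-- The residue of `∏ (z - v k) / ∏ (z - u k)` at `z = u a`. -/
noncomputable def residue {n : ℕ} (u v : Fin n → ℂ) (a : Fin n) : ℂ :=
  (∏ k, (u a - v k)) / ∏ k ∈ univ.erase a, (u a - u k)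

/-- Partial fractions, from Lagrange interpolation of the difference of the two nodal polynomials. -/
theorem prod_sub_div_prod_sub {n : ℕ} {u v : Fin n → ℂ} (hu : Function.Injective u) {z : ℂ}
    (hz : ∀ a, z - u a ≠ 0) :
    (∏ k, (z - v k)) / ∏ k, (z - u k) = 1 + ∑ a, residue u v a / (z - u a) := by
  have hdeg : (Lagrange.nodal univ v - Lagrange.nodal univ u).degree < #(univ : Finset (Fin n)) := by
    rcases Nat.eq_zero_or_pos n with rfl | hn
    · simp
    refine (Polynomial.degree_sub_lt_left ?_ (Lagrange.nodal_ne_zero) ?_).trans_eq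
      Lagrange.degree_nodal
    · simp [Lagrange.degree_nodal]
    · simp [Lagrange.nodal_monic.leadingCoeff]
  have h := Lagrange.eq_interpolate (v := u) hu.injOn hdeg
  have h2 := congrArg (Polynomial.eval z) h
  rw [Lagrange.eval_interpolate_not_at_node _ (fun i _ => sub_ne_zero.1 (hz i)),
    Polynomial.eval_sub, Lagrange.eval_nodal, Lagrange.eval_nodal] at h2
  have h0 : ∏ k, (z - u k) ≠ 0 := prod_ne_zero_iff.2 fun k _ => hz k
  rw [div_eq_iff h0, add_mul, one_mul, ← sub_eq_iff_eq_add', h2, mul_comm]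
  congr 1
  refine sum_congr rfl fun a _ => ?_
  rw [Polynomial.eval_sub, Lagrange.eval_nodal, Lagrange.eval_nodal_at_node (mem_univ a),
    Lagrange.nodalWeight, residue, prod_inv_distrib]
  simp only [div_eq_mul_inv, sub_zero]
  ring

/-- The leading coefficient in the Lagrange interpolation behind `prod_sub_div_prod_sub`. -/
theorem sum_residue {n : ℕ} {u v : Fin n → ℂ} (hu : Function.Injective u) :
    ∑ a, residue u v a = ∑ a, (u a - v a) := by
  rcases Nat.eq_zero_or_pos n with rfl | hn
  · simp
  have hdeg : (Lagrange.nodal univ v - Lagrange.nodal univ u).degree < #(univ : Finset (Fin n)) := by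
    refine (Polynomial.degree_sub_lt_left ?_ (Lagrange.nodal_ne_zero) ?_).trans_eq
      Lagrange.degree_nodal
    · simp [Lagrange.degree_nodal]
    · simp [Lagrange.nodal_monic.leadingCoeff]
  have h := Lagrange.coeff_eq_sum (v := u) hu.injOn hdeg
  have hc : ∀ w : Fin n → ℂ, (Lagrange.nodal univ w).coeff (n - 1) = - ∑ a, w a := fun w => by
    have h1 := Polynomial.prod_X_sub_C_nextCoeff (s := univ) w
    rw [Polynomial.nextCoeff_of_natDegree_pos] at h1
    · rw [← h1]
      congr 1
      simp [Polynomial.natDegree_prod_of_monic, Polynomial.monic_X_sub_C]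
    · simpa [Polynomial.natDegree_prod_of_monic, Polynomial.monic_X_sub_C] using hn
  rw [Polynomial.coeff_sub, card_univ, Fintype.card_fin, hc, hc] at h
  rw [sum_sub_distrib, ← neg_sub_neg, h]
  refine sum_congr rfl fun a _ => ?_
  rw [Polynomial.eval_sub, Lagrange.eval_nodal, Lagrange.eval_nodal_at_node (mem_univ a),
    sub_zero, residue]

/-! ### The half-line: ordered plane-wave sums as determinants -/

/-- The kernel `1 / ((x - y) (x - y + η))`, which is `t / η ^ 2` for `η = ic`. -/
noncomputable def kern (η x y : ℂ) : ℂ := ((x - y) * (x - y + η))⁻¹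

/-- The difference of the partial fraction expansion of `∏ (z - v k) / ∏ (z - u k)` at `z = v b + η`
and at its zero `z = v b`. -/
theorem prod_erase_div_prod_eq_sum_kern {n : ℕ} {η : ℂ} (hη : η ≠ 0) {u v : Fin n → ℂ}
    (hu : Function.Injective u) (h0 : ∀ i j, v i - u j ≠ 0) (h1 : ∀ i j, v i - u j + η ≠ 0)
    (b : Fin n) :
    (∏ k ∈ univ.erase b, (v b - v k + η)) / ∏ k, (v b - u k + η) =
      - ∑ a, residue u v a * kern η (v b) (u a) := by
  have e1 := prod_sub_div_prod_sub (v := v) hu (z := v b + η) fun a => by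
    have := h1 b a
    rwa [sub_add_eq_add_sub] at this
  have e2 := prod_sub_div_prod_sub (v := v) hu (z := v b) fun a => h0 b a
  rw [prod_eq_zero (mem_univ b) (sub_self _), zero_div] at e2
  have e3 : ∏ k, (v b + η - v k) = η * ∏ k ∈ univ.erase b, (v b - v k + η) := by
    rw [← mul_prod_erase univ _ (mem_univ b)]
    congr 1
    · ring
    · exact prod_congr rfl fun k _ => by ring
  have e4 : ∏ k, (v b + η - u k) = ∏ k, (v b - u k + η) :=
    prod_congr rfl fun k _ => by ring
  rw [e3, e4, mul_div_assoc] at e1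
  refine mul_left_cancel₀ hη ?_
  rw [e1, ← sub_zero (1 + _), e2, add_sub_add_left_eq_sub, ← sum_sub_distrib, mul_neg, mul_sum,
    ← sum_neg_distrib]
  refine sum_congr rfl fun a _ => ?_
  have g1 := h0 b a
  have g2 := h1 b a
  have g3 : v b + η - u a ≠ 0 := by rwa [sub_add_eq_add_sub] at g2
  rw [kern]
  field_simp
  ring

/-- The partial fraction expansion of `∏ (z - v k) / ∏ (z - u k)` at its zero `z = v b`. -/
theorem sum_residue_div_sub {n : ℕ} {u v : Fin n → ℂ}
    (hu : Function.Injective u) (h0 : ∀ i j, v i - u j ≠ 0) (b : Fin n) :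
    ∑ a, residue u v a / (v b - u a) = -1 := by
  have e2 := prod_sub_div_prod_sub (v := v) hu (z := v b) fun a => h0 b a
  rw [prod_eq_zero (mem_univ b) (sub_self _), zero_div] at e2
  linear_combination -e2

/-- The rank-two bilinear form of the adjugate of the kernel matrix that arises when the first
particle is integrated out. The two vectors are the images of the residue vectors under the
kernel matrix and its transpose, whence the adjugate disappears. -/
theorem sum_adjugate_kern {n : ℕ} {η : ℂ} (hη : η ≠ 0) {u v : Fin n → ℂ}
    (hu : Function.Injective u) (hv : Function.Injective v)
    (h0 : ∀ i j, v i - u j ≠ 0) (h1 : ∀ i j, v i - u j + η ≠ 0) :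
    ∑ a, ∑ b, (Matrix.of fun i j => kern η (v i) (u j)).adjugate a b *
      ((∏ k ∈ univ.erase a, (u k - u a + η)) / ∏ k, (v k - u a + η)) *
      ((∏ k ∈ univ.erase b, (v b - v k + η)) / ∏ k, (v b - u k + η)) * (v b - u a + η) =
    (Matrix.of fun i j => kern η (v i) (u j)).det * ∑ k, (v k - u k) := by
  classical
  set T : Matrix (Fin n) (Fin n) ℂ := Matrix.of fun i j => kern η (v i) (u j) with hT
  set r := residue u v with hr
  set s : Fin n → ℂ := fun b => - residue (fun i => - v i) (fun i => - u i) b with hs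
  set β : Fin n → ℂ := fun b => (∏ k ∈ univ.erase b, (v b - v k + η)) / ∏ k, (v b - u k + η)
    with hβ
  set α : Fin n → ℂ := fun a => (∏ k ∈ univ.erase a, (u k - u a + η)) / ∏ k, (v k - u a + η)
    with hα
  have hβr : ∀ b, β b = - ∑ a, T b a * r a := fun b => by
    rw [hβ]
    simp only
    rw [prod_erase_div_prod_eq_sum_kern hη hu h0 h1]
    simp [hT, mul_comm, hr]
  have hαs : ∀ a, α a = ∑ b, s b * T b a := fun a => by
    have := prod_erase_div_prod_eq_sum_kern (u := fun i => - v i) (v := fun i => - u i) hη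
      (neg_injective.comp hv) (fun i j => by have := h0 j i; rwa [neg_sub_neg])
      (fun i j => by have := h1 j i; rwa [neg_sub_neg]) a
    simp only [neg_sub_neg, ← sum_neg_distrib] at this
    rw [hα]
    simp only
    rw [this]
    refine sum_congr rfl fun b _ => ?_
    rw [hs, hT, Matrix.of_apply, kern, kern, neg_sub_neg, neg_mul]
  have hsum : ∑ b, s b = ∑ k, (v k - u k) := by
    rw [hs]
    simp only
    rw [sum_neg_distrib, sum_residue (u := fun i => - v i) (neg_injective.comp hv),
      ← sum_neg_distrib]
    exact sum_congr rfl fun k _ => by ring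
  have hadj1 : ∀ b, ∑ a, α a * T.adjugate a b = T.det * s b := fun b => by
    have := congrFun (congrArg (fun A => Matrix.vecMul s A) (Matrix.mul_adjugate T)) b
    simp only [← Matrix.vecMul_vecMul] at this
    have e : Matrix.vecMul s T = α := funext fun a => by
      rw [hαs]; rfl
    rw [e, Matrix.vecMul_smul, Matrix.vecMul_one] at this
    exact this
  have hadj2 : ∀ a, ∑ b, T.adjugate a b * β b = - (T.det * r a) := fun a => by
    have := congrFun (congrArg (fun A => Matrix.mulVec A r) (Matrix.adjugate_mul T)) a
    simp only [← Matrix.mulVec_mulVec] at this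
    have e : Matrix.mulVec T r = - β := funext fun b => by
      rw [Pi.neg_apply, hβr, neg_neg]; rfl
    rw [e, Matrix.smul_mulVec, Matrix.one_mulVec, Matrix.mulVec_neg] at this
    have h2 : - ∑ b, T.adjugate a b * β b = T.det * r a := this
    rw [← h2, neg_neg]
  have key : ∑ a, ∑ b, T.adjugate a b * α a * β b * (v b - u a + η) =
      ∑ b, (∑ a, α a * T.adjugate a b) * (β b * (v b + η)) -
        ∑ a, (∑ b, T.adjugate a b * β b) * (α a * u a) := by
    simp only [sum_mul]
    rw [Finset.sum_comm (f := fun b a => α a * T.adjugate a b * (β b * (v b + η))),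
      ← sum_sub_distrib]
    refine sum_congr rfl fun a _ => ?_
    rw [← sum_sub_distrib]
    exact sum_congr rfl fun b _ => by ring
  rw [key]
  simp only [hadj1, hadj2]
  rw [← hsum, mul_sum]
  have e1 : ∑ a, -(T.det * r a) * (α a * u a) =
      ∑ b, ∑ a, -(T.det * r a) * (s b * T b a * u a) := by
    rw [Finset.sum_comm]
    refine sum_congr rfl fun a _ => ?_
    rw [hαs, sum_mul, mul_sum]
  rw [e1, ← sum_sub_distrib]
  refine sum_congr rfl fun b _ => ?_
  have h2 := sum_residue_div_sub hu h0 b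
  have h3 : T.det * s b = - (T.det * s b) * ∑ a, r a / (v b - u a) := by
    rw [h2]; ring
  refine Eq.trans ?_ h3.symm
  rw [hβr, ← sum_neg_distrib, sum_mul, mul_sum, ← sum_sub_distrib, mul_sum]
  simp only [hr]
  refine sum_congr rfl fun a _ => ?_
  have g1 := h0 b a
  have g2 := h1 b a
  rw [hT, Matrix.of_apply, kern]
  field_simp
  ring

/-- The product `∏_k 1 / (d_k + d_{k+1} + ⋯)`. -/
noncomputable def tailProd : {n : ℕ} → (Fin n → ℂ) → ℂ
  | 0, _ => 1
  | _ + 1, d => (∑ j, d j)⁻¹ * tailProd (d ∘ Fin.succ)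

/-- The Bethe double sum over permutations, with the plane waves integrated over the sector
`0 < x_1 < ⋯ < x_n` and the Vandermonde denominators of the amplitudes cleared. -/
noncomputable def sectorSum {n : ℕ} (η : ℂ) (u v : Fin n → ℂ) : ℂ :=
  ∑ P : Perm (Fin n), ∑ Q : Perm (Fin n),
    ((Perm.sign P : ℤ) : ℂ) * ((Perm.sign Q : ℤ) : ℂ) *
      pairProd (fun x y => y - x + η) (u ∘ P) * pairProd (fun x y => x - y + η) (v ∘ Q) *
      tailProd (fun k => v (Q k) - u (P k))

/-- The particle next to the origin is split off. Its inverse partial sum contains all rapidities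
and therefore does not depend on the permutations. -/
theorem sectorSum_succ {n : ℕ} (η : ℂ) (u v : Fin (n + 1) → ℂ) :
    sectorSum η u v = (∑ k, (v k - u k))⁻¹ * ∑ a : Fin (n + 1), ∑ b : Fin (n + 1), (-1) ^ (a + b : ℕ) *
      (∏ k : Fin n, (u (a.succAbove k) - u a + η)) *
      (∏ k : Fin n, (v b - v (b.succAbove k) + η)) *
      sectorSum η (u ∘ a.succAbove) (v ∘ b.succAbove) := by
  rw [sectorSum, sum_perm_fin_succ, mul_sum]
  refine sum_congr rfl fun a _ => ?_
  simp_rw [sum_perm_fin_succ]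
  rw [Finset.sum_comm, mul_sum]
  refine sum_congr rfl fun b _ => ?_
  simp only [sectorSum, mul_sum]
  refine sum_congr rfl fun P _ => sum_congr rfl fun Q _ => ?_
  have hsum : ∑ k, (v (consPerm b Q k) - u (consPerm a P k)) = ∑ k, (v k - u k) := by
    rw [sum_sub_distrib, sum_sub_distrib, Equiv.sum_comp (consPerm b Q) v,
      Equiv.sum_comp (consPerm a P) u]
  have hu : (u ∘ consPerm a P) ∘ Fin.succ = (u ∘ a.succAbove) ∘ P := by
    ext; simp [consPerm_succ]
  have hv : (v ∘ consPerm b Q) ∘ Fin.succ = (v ∘ b.succAbove) ∘ Q := by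
    ext; simp [consPerm_succ]
  have hd : (fun k => v (consPerm b Q k) - u (consPerm a P k)) ∘ Fin.succ =
      fun k => (v ∘ b.succAbove) (Q k) - (u ∘ a.succAbove) (P k) := by
    ext; simp [consPerm_succ]
  rw [pairProd_succ, pairProd_succ _ (v ∘ _), tailProd, hsum, hu, hv, hd, sign_consPerm,
    sign_consPerm, pow_add]
  simp only [Function.comp, consPerm_zero, consPerm_succ]
  rw [Equiv.prod_comp P (fun k => u (a.succAbove k) - u a + η),
    Equiv.prod_comp Q (fun k => v b - v (b.succAbove k) + η)]
  ring

/-- The closed determinant form of the Bethe sum over one half-line: the partition function of the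
six-vertex model with domain wall boundary conditions. -/
theorem sectorSum_eq {n : ℕ} {η : ℂ} (hη : η ≠ 0) {u v : Fin n → ℂ}
    (hu : Function.Injective u) (hv : Function.Injective v)
    (him : ∀ i j, (u j).im < (v i).im) (h1 : ∀ i j, v i - u j + η ≠ 0) :
    sectorSum η u v = (∏ i, ∏ j, (v i - u j + η)) *
      (Matrix.of fun i j => kern η (v i) (u j)).det := by
  induction n with
  | zero => simp [sectorSum, pairProd, tailProd]
  | succ n ih =>
    have h0 : ∀ i j, v i - u j ≠ 0 := fun i j h => by
      have := congrArg Complex.im h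
      simp only [Complex.sub_im, Complex.zero_im] at this
      linarith [him i j]
    have hE : ∑ k, (v k - u k) ≠ 0 := fun h => by
      have := congrArg Complex.im h
      rw [Complex.im_sum] at this
      have h2 : 0 < ∑ k, (v k - u k).im :=
        sum_pos (fun k _ => by simpa using him k k) univ_nonempty
      simp only [Complex.zero_im] at this
      linarith
    rw [sectorSum_succ, inv_mul_eq_iff_eq_mul₀ hE, mul_left_comm, mul_comm (∑ k, (v k - u k)),
      ← sum_adjugate_kern hη hu hv h0 h1, mul_sum]
    refine sum_congr rfl fun a _ => ?_
    rw [mul_sum]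
    refine sum_congr rfl fun b _ => ?_
    rw [ih (hu.comp Fin.succAbove_right_injective) (hv.comp Fin.succAbove_right_injective)
      (fun i j => him _ _) (fun i j => h1 _ _), Matrix.adjugate_fin_succ_eq_det_submatrix]
    have e1 : ∏ k ∈ univ.erase a, (u k - u a + η) = ∏ k : Fin n, (u (a.succAbove k) - u a + η) := by
      rw [← compl_singleton, ← Fin.image_succAbove_univ,
        prod_image Fin.succAbove_right_injective.injOn]
    have e2 : ∏ k ∈ univ.erase b, (v b - v k + η) = ∏ k : Fin n, (v b - v (b.succAbove k) + η) := by
      rw [← compl_singleton, ← Fin.image_succAbove_univ,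
        prod_image Fin.succAbove_right_injective.injOn]
    have e3 : ∏ i, ∏ j, (v i - u j + η) = (∏ j, (v b - u j + η)) *
        ((∏ i : Fin n, (v (b.succAbove i) - u a + η)) *
        ∏ i : Fin n, ∏ j : Fin n, (v (b.succAbove i) - u (a.succAbove j) + η)) := by
      rw [Fin.prod_univ_succAbove _ b, ← prod_mul_distrib]
      congr 1
      exact prod_congr rfl fun i _ => Fin.prod_univ_succAbove _ a
    have e4 : ∏ k, (v k - u a + η) =
        (v b - u a + η) * ∏ i : Fin n, (v (b.succAbove i) - u a + η) :=
      Fin.prod_univ_succAbove _ b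
    have n1 : ∏ j, (v b - u j + η) ≠ 0 := prod_ne_zero_iff.2 fun j _ => h1 b j
    have n2 : ∏ i : Fin n, (v (b.succAbove i) - u a + η) ≠ 0 :=
      prod_ne_zero_iff.2 fun i _ => h1 _ a
    have n3 := h1 b a
    have e5 : (Matrix.of fun i j => kern η (v i) (u j)).submatrix b.succAbove a.succAbove =
        Matrix.of fun i j => kern η ((v ∘ b.succAbove) i) ((u ∘ a.succAbove) j) := rfl
    rw [e1, e2, e3, e4, e5, add_comm (b : ℕ)]
    simp only [Function.comp]
    field_simp

/-! ### The partition identity -/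

/-- `φ` is a polynomial function of degree at most `N`. -/
def IsPolyFun (N : ℕ) (φ : ℂ → ℂ) : Prop :=
  ∃ p : Polynomial ℂ, p.natDegree ≤ N ∧ ∀ z, p.eval z = φ z

theorem IsPolyFun.sum {ι : Type*} {N : ℕ} (s : Finset ι) {φ : ι → ℂ → ℂ}
    (h : ∀ i ∈ s, IsPolyFun N (φ i)) : IsPolyFun N (fun z => ∑ i ∈ s, φ i z) := by
  classical
  choose! p hp hp' using h
  refine ⟨∑ i ∈ s, p i, Polynomial.natDegree_sum_le_of_forall_le s p hp, fun z => ?_⟩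
  rw [Polynomial.eval_finsetSum]
  exact sum_congr rfl fun i hi => hp' i hi z

theorem IsPolyFun.mul {N K : ℕ} {φ χ : ℂ → ℂ} (h : IsPolyFun N φ) (h' : IsPolyFun K χ) :
    IsPolyFun (N + K) (fun z => φ z * χ z) := by
  obtain ⟨p, hp, hp'⟩ := h
  obtain ⟨q, hq, hq'⟩ := h'
  exact ⟨p * q, Polynomial.natDegree_mul_le_of_le hp hq, fun z => by
    rw [Polynomial.eval_mul, hp', hq']⟩

theorem IsPolyFun.const_mul {N : ℕ} {φ : ℂ → ℂ} (a : ℂ) (h : IsPolyFun N φ) :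
    IsPolyFun N (fun z => a * φ z) := by
  obtain ⟨p, hp, hp'⟩ := h
  exact ⟨Polynomial.C a * p, (Polynomial.natDegree_C_mul_le a p).trans hp, fun z => by
    rw [Polynomial.eval_mul, Polynomial.eval_C, hp']⟩

theorem IsPolyFun.sub {N : ℕ} {φ χ : ℂ → ℂ} (h : IsPolyFun N φ) (h' : IsPolyFun N χ) :
    IsPolyFun N (fun z => φ z - χ z) := by
  obtain ⟨p, hp, hp'⟩ := h
  obtain ⟨q, hq, hq'⟩ := h'
  exact ⟨p - q, (Polynomial.natDegree_sub_le_of_le hp hq).trans (by simp), fun z => by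
    rw [Polynomial.eval_sub, hp', hq']⟩

theorem isPolyFun_prod_sub {N : ℕ} (b : Fin N → ℂ) : IsPolyFun N (fun z => ∏ i, (b i - z)) := by
  refine ⟨∏ i, (Polynomial.C (b i) - Polynomial.X), ?_, fun z => ?_⟩
  · refine (Polynomial.natDegree_prod_le _ _).trans ?_
    refine (sum_le_sum (g := fun _ => 1) fun i _ => ?_).trans (by simp)
    exact (Polynomial.natDegree_sub_le _ _).trans (by simp)
  · simp [Polynomial.eval_prod]

/-- A polynomial function with more zeros than its degree vanishes. -/
theorem IsPolyFun.eq_zero {ι : Type*} [Fintype ι] {N : ℕ} {φ : ℂ → ℂ} (h : IsPolyFun N φ)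
    {x : ι → ℂ} (hx : Function.Injective x) (hN : N < Fintype.card ι) (h0 : ∀ i, φ (x i) = 0)
    (z : ℂ) : φ z = 0 := by
  obtain ⟨p, hp, hp'⟩ := h
  rw [← hp', Polynomial.eq_zero_of_natDegree_lt_card_of_eval_eq_zero p hx
    (fun i => by rw [hp', h0]) (hp.trans_lt hN), Polynomial.eval_zero]

/-- The factors of the summands of the partition identity. Indices below `n` belong to the first
group and the others to the second one. -/
noncomputable def splitFactor {M : ℕ} (η : ℂ) (n : ℕ) (u w : Fin M → ℂ) (i j : Fin M) : ℂ :=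
  if i.val < n then (if j.val < n then u i - w j + η else u j - u i + η)
  else (if j.val < n then w i - w j else w i - u j)

/-- The factors of the right hand side of the partition identity. -/
noncomputable def joinFactor {M : ℕ} (η : ℂ) (n : ℕ) (w : Fin M → ℂ) (x : ℂ) (j : Fin M) : ℂ :=
  if j.val < n then x - w j + η else w j - x

/-- The left hand side of the partition identity vanishes when two of the `w k` in the first group
coincide, by antisymmetry. -/
theorem sum_split_eq_zero {M : ℕ} (η : ℂ) (n : ℕ) (u w : Fin M → ℂ) {k l : Fin M} (hkl : k ≠ l)
    (hk : k.val < n) (hl : l.val < n) (hw : w k = w l) :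
    ∑ P : Perm (Fin M), ((Perm.sign P : ℤ) : ℂ) *
      ((∏ i, ∏ j, splitFactor η n (u ∘ P) w i j) * ∏ i, kern η (u (P i)) (w i)) = 0 := by
  set S := ∑ P : Perm (Fin M), ((Perm.sign P : ℤ) : ℂ) *
      ((∏ i, ∏ j, splitFactor η n (u ∘ P) w i j) * ∏ i, kern η (u (P i)) (w i)) with hS
  have hτw : ∀ i, w (swap k l i) = w i := fun i => by
    rcases eq_or_ne i k with rfl | h1
    · simp [hw]
    rcases eq_or_ne i l with rfl | h2
    · simp [hw]
    rw [swap_apply_of_ne_of_ne h1 h2]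
  have hτn : ∀ i, (swap k l i).val < n ↔ i.val < n := fun i => by
    rcases eq_or_ne i k with rfl | h1
    · simp [hk, hl]
    rcases eq_or_ne i l with rfl | h2
    · simp [hk, hl]
    rw [swap_apply_of_ne_of_ne h1 h2]
  have h : S = -S := by
    rw [hS, ← sum_neg_distrib, ← Equiv.sum_comp (Equiv.mulRight (swap k l))]
    refine sum_congr rfl fun P _ => ?_
    have e1 : ∏ i, ∏ j, splitFactor η n (u ∘ (P * swap k l)) w i j =
        ∏ i, ∏ j, splitFactor η n (u ∘ P) w i j := by
      rw [← Equiv.prod_comp (swap k l) (fun i => ∏ j, splitFactor η n (u ∘ P) w i j)]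
      refine prod_congr rfl fun i _ => ?_
      rw [← Equiv.prod_comp (swap k l)
        (fun j => splitFactor η n (u ∘ P) w (swap k l i) j)]
      refine prod_congr rfl fun j _ => ?_
      simp only [splitFactor, hτn, hτw, Function.comp, Perm.mul_apply]
    have e2 : ∏ i, kern η (u ((P * swap k l) i)) (w i) = ∏ i, kern η (u (P i)) (w i) := by
      rw [← Equiv.prod_comp (swap k l) (fun i => kern η (u (P i)) (w i))]
      simp only [hτw, Perm.mul_apply]
    rw [Equiv.coe_mulRight, e1, e2, Perm.sign_mul, Perm.sign_swap hkl]
    push_cast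
    ring
  linear_combination h / 2

theorem sum_kern_eq_zero {M : ℕ} (η : ℂ) (u w : Fin M → ℂ) {k l : Fin M} (hkl : k ≠ l)
    (hw : w k = w l) :
    ∑ P : Perm (Fin M), ((Perm.sign P : ℤ) : ℂ) * ∏ i, kern η (u (P i)) (w i) = 0 := by
  have := Matrix.det_apply' (Matrix.of fun i j => kern η (u i) (w j))
  simp only [Matrix.of_apply] at this
  rw [← this]
  exact Matrix.det_zero_of_column_eq hkl fun i => by simp [hw]

theorem prod_split_cons {M : ℕ} (η : ℂ) (n : ℕ) (u w : Fin (M + 1) → ℂ) (a : Fin (M + 1))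
    (σ : Perm (Fin M)) :
    ∏ i, ∏ j, splitFactor η (n + 1) (u ∘ consPerm a σ) w i j =
      (u a - w 0 + η) * (∏ j : Fin M, if j.val < n then u a - w j.succ + η
        else u (a.succAbove (σ j)) - u a + η) *
      (∏ i : Fin M, if i.val < n then u (a.succAbove (σ i)) - w 0 + η else w i.succ - w 0) *
      ∏ i, ∏ j, splitFactor η n ((u ∘ a.succAbove) ∘ σ) (w ∘ Fin.succ) i j := by
  simp only [Fin.prod_univ_succ, splitFactor, Function.comp, consPerm_zero, consPerm_succ,
    prod_mul_distrib, Fin.val_zero, Fin.val_succ, Nat.zero_lt_succ, if_true,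
    add_lt_add_iff_right]
  ring

theorem prod_kern_cons {M : ℕ} (η : ℂ) (u w : Fin (M + 1) → ℂ) (a : Fin (M + 1))
    (σ : Perm (Fin M)) :
    ∏ i, kern η (u (consPerm a σ i)) (w i) = kern η (u a) (w 0) *
      ∏ i, kern η ((u ∘ a.succAbove) (σ i)) ((w ∘ Fin.succ) i) := by
  simp [Fin.prod_univ_succ, consPerm_zero, consPerm_succ]

/-- The left hand side of the partition identity as a polynomial in `z = w 0`, after
multiplication by `∏ (u k - z)`. -/
noncomputable def splitPoly {M : ℕ} (η : ℂ) (n : ℕ) (u : Fin (M + 1) → ℂ) (w : Fin M → ℂ)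
    (z : ℂ) : ℂ :=
  ∑ a : Fin (M + 1), ∑ σ : Perm (Fin M), ((-1) ^ (a : ℕ) * ((Perm.sign σ : ℤ) : ℂ) *
    (∏ j : Fin M, if j.val < n then u a - w j + η else u (a.succAbove (σ j)) - u a + η) *
    (∏ i, ∏ j, splitFactor η n ((u ∘ a.succAbove) ∘ σ) w i j) *
    ∏ i, kern η ((u ∘ a.succAbove) (σ i)) (w i)) *
    ((∏ i : Fin M, ((if i.val < n then u (a.succAbove (σ i)) + η else w i) - z)) *
    ∏ k : Fin M, (u (a.succAbove k) - z))

/-- The right hand side of the partition identity as a polynomial in `z = w 0`, after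
multiplication by `∏ (u k - z)`. -/
noncomputable def joinPoly {M : ℕ} (η : ℂ) (n : ℕ) (u : Fin (M + 1) → ℂ) (w : Fin M → ℂ)
    (z : ℂ) : ℂ :=
  ∑ a : Fin (M + 1), ∑ σ : Perm (Fin M), ((-1) ^ (a : ℕ) * ((Perm.sign σ : ℤ) : ℂ) *
    (∏ i, ∏ j, joinFactor η n w (u i) j) * ∏ i, kern η ((u ∘ a.succAbove) (σ i)) (w i)) *
    ((∏ i : Fin M, (u (a.succAbove i) + η - z)) * ∏ k : Fin M, (u (a.succAbove k) - z))

theorem isPolyFun_splitPoly {M : ℕ} (η : ℂ) (n : ℕ) (u : Fin (M + 1) → ℂ) (w : Fin M → ℂ) :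
    IsPolyFun (M + M) (splitPoly η n u w) :=
  IsPolyFun.sum _ fun _ _ => IsPolyFun.sum _ fun _ _ => IsPolyFun.const_mul _
    ((isPolyFun_prod_sub _).mul (isPolyFun_prod_sub _))

theorem isPolyFun_joinPoly {M : ℕ} (η : ℂ) (n : ℕ) (u : Fin (M + 1) → ℂ) (w : Fin M → ℂ) :
    IsPolyFun (M + M) (joinPoly η n u w) :=
  IsPolyFun.sum _ fun _ _ => IsPolyFun.sum _ fun _ _ => IsPolyFun.const_mul _
    ((isPolyFun_prod_sub _).mul (isPolyFun_prod_sub _))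

theorem splitPoly_eq {M : ℕ} (η : ℂ) (n : ℕ) (u w : Fin (M + 1) → ℂ)
    (h0 : ∀ i, u i - w 0 ≠ 0) (h1 : ∀ i, u i - w 0 + η ≠ 0) :
    splitPoly η n u (w ∘ Fin.succ) (w 0) = (∏ k, (u k - w 0)) *
      ∑ P : Perm (Fin (M + 1)), ((Perm.sign P : ℤ) : ℂ) *
        ((∏ i, ∏ j, splitFactor η (n + 1) (u ∘ P) w i j) * ∏ i, kern η (u (P i)) (w i)) := by
  rw [sum_perm_fin_succ, mul_sum]
  refine sum_congr rfl fun a _ => ?_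
  rw [mul_sum]
  refine sum_congr rfl fun σ _ => ?_
  rw [prod_split_cons, prod_kern_cons, sign_consPerm, Fin.prod_univ_succAbove _ a]
  have e : ∏ i : Fin M, ((if i.val < n then u (a.succAbove (σ i)) + η else (w ∘ Fin.succ) i) - w 0)
      = ∏ i : Fin M, if i.val < n then u (a.succAbove (σ i)) - w 0 + η else w i.succ - w 0 :=
    prod_congr rfl fun i _ => by
      rw [Function.comp_apply]
      split_ifs <;> ring
  rw [e, kern]
  have g0 := h0 a
  have g1 := h1 a
  simp only [Function.comp]
  field_simp

theorem joinPoly_eq {M : ℕ} (η : ℂ) (n : ℕ) (u w : Fin (M + 1) → ℂ)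
    (h0 : ∀ i, u i - w 0 ≠ 0) (h1 : ∀ i, u i - w 0 + η ≠ 0) :
    joinPoly η n u (w ∘ Fin.succ) (w 0) = (∏ k, (u k - w 0)) *
      ((∏ i, ∏ j, joinFactor η (n + 1) w (u i) j) *
        ∑ P : Perm (Fin (M + 1)), ((Perm.sign P : ℤ) : ℂ) * ∏ i, kern η (u (P i)) (w i)) := by
  rw [sum_perm_fin_succ, mul_sum, mul_sum]
  refine sum_congr rfl fun a _ => ?_
  rw [mul_sum, mul_sum]
  refine sum_congr rfl fun σ _ => ?_
  have e1 : ∏ i, ∏ j, joinFactor η (n + 1) w (u i) j = (∏ i, (u i + η - w 0)) *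
      ∏ i, ∏ j, joinFactor η n (w ∘ Fin.succ) (u i) j := by
    rw [← prod_mul_distrib]
    refine prod_congr rfl fun i _ => ?_
    rw [Fin.prod_univ_succ]
    simp [joinFactor, add_sub_right_comm]
  rw [e1, prod_kern_cons, sign_consPerm, Fin.prod_univ_succAbove (fun k => u k - w 0) a,
    Fin.prod_univ_succAbove (fun k => u k + η - w 0) a, kern]
  have g0 := h0 a
  have g1 := h1 a
  have g2 : u a + η - w 0 = u a - w 0 + η := by ring
  rw [g2]
  field_simp

/-- The partition identity: the sum over all distributions of the `u k` among the two groups of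
products of two determinants is a single determinant. -/
theorem sum_split_eq_join {M : ℕ} (η : ℂ) (n : ℕ) (u w : Fin M → ℂ)
    (hu : Function.Injective u) (hw : Function.Injective w)
    (h0 : ∀ i j, u i - w j ≠ 0) (h1 : ∀ i j, u i - w j + η ≠ 0) :
    ∑ P : Perm (Fin M), ((Perm.sign P : ℤ) : ℂ) *
        ((∏ i, ∏ j, splitFactor η n (u ∘ P) w i j) * ∏ i, kern η (u (P i)) (w i)) =
      (∏ i, ∏ j, joinFactor η n w (u i) j) *
        ∑ P : Perm (Fin M), ((Perm.sign P : ℤ) : ℂ) * ∏ i, kern η (u (P i)) (w i) := by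
  induction n generalizing M with
  | zero =>
    rw [mul_sum]
    refine sum_congr rfl fun P _ => ?_
    have : ∏ i, ∏ j, splitFactor η 0 (u ∘ P) w i j = ∏ i, ∏ j, joinFactor η 0 w (u i) j := by
      simp only [splitFactor, joinFactor, Nat.not_lt_zero, if_false, Function.comp]
      rw [Finset.prod_comm]
      exact Equiv.prod_comp P fun i => ∏ j, (w j - u i)
    rw [this]
    ring
  | succ n ih =>
    cases M with
    | zero => simp
    | succ M =>
      suffices h : splitPoly η n u (w ∘ Fin.succ) (w 0) - joinPoly η n u (w ∘ Fin.succ) (w 0) = 0 by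
        rw [splitPoly_eq η n u w (fun i => h0 i 0) (fun i => h1 i 0),
          joinPoly_eq η n u w (fun i => h0 i 0) (fun i => h1 i 0), sub_eq_zero] at h
        exact mul_left_cancel₀ (prod_ne_zero_iff.2 fun k _ => h0 k 0) h
      refine ((isPolyFun_splitPoly η n u (w ∘ Fin.succ)).sub
        (isPolyFun_joinPoly η n u (w ∘ Fin.succ))).eq_zero
        (x := Sum.elim u (w ∘ Fin.succ)) ?_ ?_ ?_ (w 0)
      · exact hu.sumElim (hw.comp (Fin.succ_injective _)) fun i j => sub_ne_zero.1 (h0 i _)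
      · simp
      rintro (a | k)
      · -- at `z = u a` only the permutations with `P 0 = a` contribute
        have hne : ∀ b, b ≠ a → ∏ k : Fin M, (u (b.succAbove k) - u a) = 0 := fun b hb => by
          obtain ⟨k, hk⟩ := Fin.exists_succAbove_eq hb.symm
          exact prod_eq_zero (mem_univ k) (by rw [hk, sub_self])
        rw [Sum.elim_inl, sub_eq_zero, splitPoly, joinPoly,
          sum_eq_single_of_mem a (mem_univ a) (fun b _ hb => by simp [hne b hb]),
          sum_eq_single_of_mem a (mem_univ a) (fun b _ hb => by simp [hne b hb])]
        have IH := ih (u ∘ a.succAbove) (w ∘ Fin.succ) (hu.comp Fin.succAbove_right_injective)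
          (hw.comp (Fin.succ_injective _)) (fun i j => h0 _ _) (fun i j => h1 _ _)
        have e1 : ∀ σ : Perm (Fin M),
            (∏ j : Fin M, if j.val < n then u a - (w ∘ Fin.succ) j + η
              else u (a.succAbove (σ j)) - u a + η) *
            (∏ i : Fin M,
              ((if i.val < n then u (a.succAbove (σ i)) + η else (w ∘ Fin.succ) i) - u a)) =
            (∏ i : Fin M, (u (a.succAbove i) + η - u a)) *
              ∏ j, joinFactor η n (w ∘ Fin.succ) (u a) j := fun σ => by
          rw [← Equiv.prod_comp σ (fun i => u (a.succAbove i) + η - u a), ← prod_mul_distrib, ← prod_mul_distrib]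
          refine prod_congr rfl fun j _ => ?_
          rw [joinFactor]
          split_ifs <;> ring
        have e2 : ∏ i, ∏ j, joinFactor η n (w ∘ Fin.succ) (u i) j =
            (∏ j, joinFactor η n (w ∘ Fin.succ) (u a) j) *
              ∏ i, ∏ j, joinFactor η n (w ∘ Fin.succ) ((u ∘ a.succAbove) i) j :=
          Fin.prod_univ_succAbove _ a
        have e3 := congrArg (fun x => (-1) ^ (a : ℕ) * (∏ i : Fin M, (u (a.succAbove i) + η - u a)) *
          (∏ j, joinFactor η n (w ∘ Fin.succ) (u a) j) *
          (∏ k : Fin M, (u (a.succAbove k) - u a)) * x) IH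
        simp only [mul_sum] at e3
        refine Eq.trans (sum_congr rfl fun σ _ => ?_) (e3.trans (sum_congr rfl fun σ _ => ?_))
        · linear_combination ((-1) ^ (a : ℕ) * ((Perm.sign σ : ℤ) : ℂ) *
            (∏ i, ∏ j, splitFactor η n ((u ∘ a.succAbove) ∘ σ) (w ∘ Fin.succ) i j) *
            (∏ i, kern η ((u ∘ a.succAbove) (σ i)) ((w ∘ Fin.succ) i)) *
            ∏ k : Fin M, (u (a.succAbove k) - u a)) * e1 σ
        · rw [e2]
          ring
      · -- at `z = w k` both sides vanish, in the same group by antisymmetry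
        rw [Sum.elim_inr, Function.comp_apply]
        have hjoin := joinPoly_eq η n u (Fin.cons (w k.succ) (w ∘ Fin.succ))
          (fun i => h0 i _) (fun i => h1 i _)
        have hsplit := splitPoly_eq η n u (Fin.cons (w k.succ) (w ∘ Fin.succ))
          (fun i => h0 i _) (fun i => h1 i _)
        rw [sum_kern_eq_zero η u _ (Fin.succ_ne_zero k).symm (by simp), mul_zero, mul_zero] at hjoin
        rw [Fin.cons_zero, Fin.cons_comp_succ] at hjoin hsplit
        rw [hjoin, sub_zero]
        by_cases hk : k.val < n
        · rw [hsplit, sum_split_eq_zero η (n + 1) u _ (Fin.succ_ne_zero k).symm (by simp)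
            (by simpa using hk) (by simp), mul_zero]
        · rw [splitPoly]
          refine sum_eq_zero fun a _ => sum_eq_zero fun σ _ => ?_
          have hz : ∏ i : Fin M, ((if i.val < n then u (a.succAbove (σ i)) + η
              else (w ∘ Fin.succ) i) - w k.succ) = 0 :=
            prod_eq_zero (mem_univ k) (by simp [hk])
          rw [hz, zero_mul, mul_zero]

/-! ### Averaging over the permutations of two groups -/

/-- The permutation of `Fin (n + m)` that acts by `p` on the first `n` and by `q` on the last `m`
elements. -/
def blockPerm {n m : ℕ} (p : Perm (Fin n)) (q : Perm (Fin m)) : Perm (Fin (n + m)) :=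
  finSumFinEquiv.permCongr (Perm.sumCongr p q)

@[simp]
theorem blockPerm_castAdd {n m : ℕ} (p : Perm (Fin n)) (q : Perm (Fin m)) (i : Fin n) :
    blockPerm p q (Fin.castAdd m i) = Fin.castAdd m (p i) := by
  simp [blockPerm, Equiv.permCongr_apply]

@[simp]
theorem blockPerm_natAdd {n m : ℕ} (p : Perm (Fin n)) (q : Perm (Fin m)) (i : Fin m) :
    blockPerm p q (Fin.natAdd n i) = Fin.natAdd n (q i) := by
  simp [blockPerm, Equiv.permCongr_apply]

theorem sign_mul_blockPerm {n m : ℕ} (P : Perm (Fin (n + m))) (p : Perm (Fin n))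
    (q : Perm (Fin m)) : ((Perm.sign (P * blockPerm p q) : ℤ) : ℂ) =
      ((Perm.sign P : ℤ) : ℂ) * (((Perm.sign p : ℤ) : ℂ) * ((Perm.sign q : ℤ) : ℂ)) := by
  simp [blockPerm, Perm.sign_mul, Perm.sign_permCongr, Perm.sign_sumCongr]

/-- Averaging over the permutations of the two blocks. -/
theorem sum_sum_mul_blockPerm {n m : ℕ} (φ : Perm (Fin (n + m)) → ℂ) :
    ∑ P, ∑ p : Perm (Fin n), ∑ q : Perm (Fin m), φ (P * blockPerm p q) =
      (n.factorial * m.factorial : ℂ) * ∑ P, φ P := by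
  rw [Finset.sum_comm]
  simp_rw [Finset.sum_comm (s := (univ : Finset (Perm (Fin (n + m)))))]
  have h : ∀ (p : Perm (Fin n)) (q : Perm (Fin m)),
      ∑ P, φ (P * blockPerm p q) = ∑ P, φ P := fun p q =>
    Equiv.sum_comp (Equiv.mulRight (blockPerm p q)) φ
  simp only [h, sum_const, card_univ, Fintype.card_perm, Fintype.card_fin, nsmul_eq_mul]
  ring

theorem sum_sum_mul_blockPerm_blockPerm {n m : ℕ} (φ : Perm (Fin (n + m)) → Perm (Fin (n + m)) → ℂ) :
    ∑ P, ∑ Q, ∑ p : Perm (Fin n), ∑ p' : Perm (Fin m), ∑ q : Perm (Fin n), ∑ q' : Perm (Fin m),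
        φ (P * blockPerm p p') (Q * blockPerm q q') =
      (n.factorial * m.factorial : ℂ) ^ 2 * ∑ P, ∑ Q, φ P Q := by
  have h : ∀ P, ∑ Q, ∑ p : Perm (Fin n), ∑ p' : Perm (Fin m), ∑ q : Perm (Fin n),
      ∑ q' : Perm (Fin m), φ (P * blockPerm p p') (Q * blockPerm q q') =
      ∑ p : Perm (Fin n), ∑ p' : Perm (Fin m), ∑ Q, ∑ q : Perm (Fin n),
      ∑ q' : Perm (Fin m), φ (P * blockPerm p p') (Q * blockPerm q q') := fun P => by
    rw [Finset.sum_comm]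
    exact sum_congr rfl fun p _ => Finset.sum_comm
  simp_rw [h]
  rw [sum_sum_mul_blockPerm (fun P => ∑ Q, ∑ q : Perm (Fin n), ∑ q' : Perm (Fin m),
    φ P (Q * blockPerm q q')), sum_congr rfl fun P _ => sum_sum_mul_blockPerm (φ P), ← mul_sum]
  ring

/-- Every `n`-subset is the image of the first `n` indices under `n! m!` permutations. -/
theorem sum_perm_image {n m : ℕ} (φ : Finset (Fin (n + m)) → ℂ) :
    ∑ Q : Perm (Fin (n + m)), φ ((univ.filter fun i : Fin (n + m) => i.val < n).image Q) =
      (n.factorial * m.factorial : ℂ) * ∑ J ∈ powersetCard n univ, φ J := by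
  classical
  set h : Finset (Fin (n + m)) := univ.filter fun i : Fin (n + m) => i.val < n with hh
  have hcard : #h = n := by
    rw [hh, Fin.card_filter_val_lt]; simp
  have hmem : ∀ Q ∈ (univ : Finset (Perm (Fin (n + m)))), h.image Q ∈ powersetCard n univ :=
    fun Q _ => by
      rw [mem_powersetCard]
      exact ⟨subset_univ _, by rw [card_image_of_injective _ Q.injective, hcard]⟩
  -- the number of permutations that map `h` to `J` does not depend on `J`
  have hunif : ∀ J ∈ powersetCard n (univ : Finset (Fin (n + m))),
      #{Q : Perm (Fin (n + m)) | h.image Q = J} = #{Q : Perm (Fin (n + m)) | h.image Q = h} := by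
    intro J hJ
    have hJc : #J = n := (mem_powersetCard.1 hJ).2
    have e : {x // x ∈ h} ≃ {x // x ∈ J} := Fintype.equivOfCardEq (by simp [hcard, hJc])
    let R : Perm (Fin (n + m)) := e.extendSubtype
    have hR : h.image R = J := by
      refine eq_of_subset_of_card_le (fun x hx => ?_) ?_
      · obtain ⟨y, hy, rfl⟩ := mem_image.1 hx
        exact e.extendSubtype_mem y hy
      · rw [card_image_of_injective _ R.injective, hcard, hJc]
    symm
    refine card_bij' (fun Q _ => R * Q) (fun Q _ => R⁻¹ * Q) ?_ ?_ ?_ ?_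
    · intro Q hQ
      simp only [mem_filter, mem_univ, true_and] at hQ ⊢
      rw [Perm.coe_mul, ← image_image, hQ, hR]
    · intro Q hQ
      simp only [mem_filter, mem_univ, true_and] at hQ ⊢
      rw [Perm.coe_mul, ← image_image, hQ, ← hR, image_image, ← Perm.coe_mul]
      simp
    · intro Q _; simp
    · intro Q _; simp
  have htot : (n + m).choose n * #{Q : Perm (Fin (n + m)) | h.image Q = h} = (n + m).factorial := by
    have := card_eq_sum_card_fiberwise hmem
    rw [card_univ, Fintype.card_perm, Fintype.card_fin, sum_congr rfl hunif, sum_const,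
      card_powersetCard, card_univ, Fintype.card_fin, smul_eq_mul] at this
    exact this.symm
  have hN : #{Q : Perm (Fin (n + m)) | h.image Q = h} = n.factorial * m.factorial := by
    have h2 := Nat.add_choose_mul_factorial_mul_factorial n m
    rw [mul_assoc, ← htot, ← Nat.choose_symm_add] at h2
    exact (Nat.eq_of_mul_eq_mul_left (Nat.choose_pos (Nat.le_add_right n m)) h2).symm
  rw [← sum_fiberwise_of_maps_to hmem, mul_sum]
  refine sum_congr rfl fun J hJ => ?_
  rw [sum_congr rfl (g := fun _ => φ J) fun Q hQ => by rw [(mem_filter.1 hQ).2], sum_const,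
    hunif J hJ, hN, nsmul_eq_mul]
  push_cast
  ring

theorem pairProd_add_const {n : ℕ} (η δ : ℂ) (w : Fin n → ℂ) :
    pairProd (fun x y => x - y + η) (fun i => w i + δ) = pairProd (fun x y => x - y + η) w := by
  unfold pairProd
  simp only [add_sub_add_right_eq_sub]

/-- The product of amplitudes between particles of different groups. -/
noncomputable def crossProd {n m : ℕ} (η : ℂ) (u v : Fin (n + m) → ℂ) : ℂ :=
  ∏ i : Fin n, ∏ j : Fin m, ((u (Fin.natAdd n j) - u (Fin.castAdd m i) + η) *
    (v (Fin.castAdd m i) - v (Fin.natAdd n j) + η))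

theorem crossProd_mul_blockPerm {n m : ℕ} (η : ℂ) (u v : Fin (n + m) → ℂ)
    (p q : Perm (Fin n)) (p' q' : Perm (Fin m)) :
    crossProd η (u ∘ blockPerm p p') (v ∘ blockPerm q q') = crossProd η u v := by
  unfold crossProd
  simp only [prod_mul_distrib, Function.comp, blockPerm_castAdd, blockPerm_natAdd]
  congr 1
  · rw [← Equiv.prod_comp p (fun i => ∏ j, (u (Fin.natAdd n j) - u (Fin.castAdd m i) + η))]
    exact prod_congr rfl fun i _ =>
      Equiv.prod_comp p' (fun j => u (Fin.natAdd n j) - u (Fin.castAdd m (p i)) + η)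
  · rw [← Equiv.prod_comp q (fun i => ∏ j, (v (Fin.castAdd m i) - v (Fin.natAdd n j) + η))]
    exact prod_congr rfl fun i _ =>
      Equiv.prod_comp q' (fun j => v (Fin.castAdd m (q i)) - v (Fin.natAdd n j) + η)

/-- The Bethe double sum integrated over the sector with `n` negative and `m` positive
coordinates. The damping shifts `v` by `-δ` on the negative and by `δ` on the positive half-line. -/
noncomputable def twoSectorSum {n m : ℕ} (η δ : ℂ) (u v : Fin (n + m) → ℂ) : ℂ :=
  ∑ P : Perm (Fin (n + m)), ∑ Q : Perm (Fin (n + m)),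
    ((Perm.sign P : ℤ) : ℂ) * ((Perm.sign Q : ℤ) : ℂ) *
      pairProd (fun x y => y - x + η) (u ∘ P) * pairProd (fun x y => x - y + η) (v ∘ Q) *
      (tailProd (fun k : Fin n => u (P (Fin.castAdd m k.rev)) - (v (Q (Fin.castAdd m k.rev)) + -δ)) *
      tailProd (fun k : Fin m => v (Q (Fin.natAdd n k)) + δ - u (P (Fin.natAdd n k))))

/-- The reflection of the line reverses the order of the particles, which exchanges the roles of the
two sets of rapidities. -/
theorem sectorSum_rev {n : ℕ} (η : ℂ) (u v : Fin n → ℂ) :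
    ∑ p : Perm (Fin n), ∑ q : Perm (Fin n), ((Perm.sign p : ℤ) : ℂ) * ((Perm.sign q : ℤ) : ℂ) *
      pairProd (fun x y => y - x + η) (u ∘ p) * pairProd (fun x y => x - y + η) (v ∘ q) *
      tailProd (fun k => u (p k.rev) - v (q k.rev)) = sectorSum η v u := by
  rw [sectorSum, Finset.sum_comm, ← Equiv.sum_comp (Equiv.mulRight Fin.revPerm)]
  refine sum_congr rfl fun q _ => ?_
  rw [← Equiv.sum_comp (Equiv.mulRight Fin.revPerm)]
  refine sum_congr rfl fun p _ => ?_
  have hu : u ∘ (p * Fin.revPerm : Perm (Fin n)) = (u ∘ p) ∘ Fin.rev := rfl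
  have hv : v ∘ (q * Fin.revPerm : Perm (Fin n)) = (v ∘ q) ∘ Fin.rev := rfl
  have hs : ((Perm.sign (Fin.revPerm : Perm (Fin n)) : ℤ) : ℂ) *
      ((Perm.sign (Fin.revPerm : Perm (Fin n)) : ℤ) : ℂ) = 1 := by
    rcases Int.units_eq_one_or (Perm.sign (Fin.revPerm : Perm (Fin n))) with h | h <;> simp [h]
  simp only [Equiv.coe_mulRight]
  rw [hu, hv, pairProd_rev, pairProd_rev, Perm.sign_mul, Perm.sign_mul]
  have ht : (fun k : Fin n => u ((p * Fin.revPerm : Perm (Fin n)) k.rev) -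
      v ((q * Fin.revPerm : Perm (Fin n)) k.rev)) =
      fun k => u (p k) - v (q k) := by
    ext k; simp
  rw [ht]
  push_cast
  linear_combination (((Perm.sign p : ℤ) : ℂ) * ((Perm.sign q : ℤ) : ℂ) *
      pairProd (fun x y => y - x + η) (v ∘ q) * pairProd (fun x y => x - y + η) (u ∘ p) *
      tailProd (fun k => u (p k) - v (q k))) * hs

/-- For a fixed distribution of the rapidities among the half-lines, the sums over the orderings
factor into one sum for each half-line. -/
theorem twoSectorSum_eq {n m : ℕ} (η δ : ℂ) (u v : Fin (n + m) → ℂ) :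
    (n.factorial * m.factorial : ℂ) ^ 2 * twoSectorSum (n := n) (m := m) η δ u v =
      ∑ P : Perm (Fin (n + m)), ∑ Q : Perm (Fin (n + m)),
        ((Perm.sign P : ℤ) : ℂ) * ((Perm.sign Q : ℤ) : ℂ) * crossProd η (u ∘ P) (v ∘ Q) *
        (sectorSum η (fun i => v (Q (Fin.castAdd m i)) + -δ) (fun i => u (P (Fin.castAdd m i))) *
        sectorSum η (fun i => u (P (Fin.natAdd n i))) (fun i => v (Q (Fin.natAdd n i)) + δ)) := by
  rw [twoSectorSum, ← sum_sum_mul_blockPerm_blockPerm]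
  refine sum_congr rfl fun P _ => sum_congr rfl fun Q _ => ?_
  have hsplit : ∀ A : Perm (Fin n) → Perm (Fin n) → ℂ, ∀ A' : Perm (Fin m) → Perm (Fin m) → ℂ,
      (∑ p, ∑ q, A p q) * (∑ p', ∑ q', A' p' q') =
        ∑ p, ∑ p', ∑ q, ∑ q', A p q * A' p' q' := fun A A' => by
    rw [sum_mul_sum]
    refine sum_congr rfl fun p _ => sum_congr rfl fun p' _ => ?_
    rw [sum_mul_sum]
  rw [← sectorSum_rev, sectorSum, hsplit]
  simp only [mul_sum]
  refine sum_congr rfl fun p _ => sum_congr rfl fun p' _ =>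
    sum_congr rfl fun q _ => sum_congr rfl fun q' _ => ?_
  have hc := crossProd_mul_blockPerm η (u ∘ P) (v ∘ Q) p q p' q'
  have hu1 : (u ∘ (P * blockPerm p p' : Perm _)) ∘ Fin.castAdd m =
      (fun i => u (P (Fin.castAdd m i))) ∘ p := by ext; simp
  have hu2 : (u ∘ (P * blockPerm p p' : Perm _)) ∘ Fin.natAdd n =
      (fun i => u (P (Fin.natAdd n i))) ∘ p' := by ext; simp
  have hv1 : pairProd (fun x y => x - y + η) ((fun i => v (Q (Fin.castAdd m i)) + -δ) ∘ q) =
      pairProd (fun x y => x - y + η) ((v ∘ (Q * blockPerm q q' : Perm _)) ∘ Fin.castAdd m) := by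
    rw [← pairProd_add_const η (-δ) ((v ∘ _) ∘ _)]
    congr 1; ext; simp
  have hv2 : pairProd (fun x y => x - y + η) ((fun i => v (Q (Fin.natAdd n i)) + δ) ∘ q') =
      pairProd (fun x y => x - y + η) ((v ∘ (Q * blockPerm q q' : Perm _)) ∘ Fin.natAdd n) := by
    rw [← pairProd_add_const η δ ((v ∘ _) ∘ _)]
    congr 1; ext; simp
  rw [hv1, hv2, pairProd_add, pairProd_add _ (v ∘ _), hu1, hu2, sign_mul_blockPerm,
    sign_mul_blockPerm, ← hc, crossProd]
  simp only [Perm.mul_apply, blockPerm_castAdd, blockPerm_natAdd, prod_mul_distrib,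
    Function.comp]
  ring

/-! ### The contribution of a fixed set of negative rapidities -/

/-- The contribution of the subset `J` of the `v i` that sits on the negative half-line. -/
noncomputable def subsetTerm {M : ℕ} (η : ℂ) (u v : Fin M → ℂ) (J : Finset (Fin M)) : ℂ :=
  (∏ i, ∏ j, if j ∈ J then u i - v j + η else v j - u i + η) *
    (∏ i, ∏ j, if i ∉ J ∧ j ∈ J then (v j - v i + η) / (v i - v j + η) else 1) *
    (Matrix.of fun i j => if i ∈ J then kern η (u j) (v i) else kern η (v i) (u j)).det

/-- The right hand side of `sectorSum_eq`. -/
noncomputable def sectorDet {n : ℕ} (η : ℂ) (u v : Fin n → ℂ) : ℂ :=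
  (∏ i, ∏ j, (v i - u j + η)) * (Matrix.of fun i j => kern η (v i) (u j)).det

/-- The two determinants are absorbed into the sum over all permutations. -/
theorem sum_sectorDet_mul_sectorDet {n m : ℕ} {η : ℂ} {u v : Fin (n + m) → ℂ} :
    ∑ P : Perm (Fin (n + m)), ((Perm.sign P : ℤ) : ℂ) *
      ((∏ i : Fin n, ∏ j : Fin m, (u (P (Fin.natAdd n j)) - u (P (Fin.castAdd m i)) + η)) *
      (sectorDet η (fun i => v (Fin.castAdd m i)) (fun i => u (P (Fin.castAdd m i))) *
      sectorDet η (fun i => u (P (Fin.natAdd n i))) (fun i => v (Fin.natAdd n i)))) =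
    (n.factorial * m.factorial : ℂ) * ∑ P : Perm (Fin (n + m)), ((Perm.sign P : ℤ) : ℂ) *
      ((∏ i : Fin n, ∏ j : Fin m, (u (P (Fin.natAdd n j)) - u (P (Fin.castAdd m i)) + η)) *
      (((∏ i : Fin n, ∏ j : Fin n, (u (P (Fin.castAdd m i)) - v (Fin.castAdd m j) + η)) *
        ∏ i : Fin n, kern η (u (P (Fin.castAdd m i))) (v (Fin.castAdd m i))) *
      ((∏ i : Fin m, ∏ j : Fin m, (v (Fin.natAdd n i) - u (P (Fin.natAdd n j)) + η)) *
        ∏ i : Fin m, kern η (v (Fin.natAdd n i)) (u (P (Fin.natAdd n i)))))) := by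
  rw [← sum_sum_mul_blockPerm]
  refine sum_congr rfl fun P _ => ?_
  have hd : (Matrix.of fun i j : Fin m =>
      kern η (v (Fin.natAdd n i)) (u (P (Fin.natAdd n j)))).det =
      ∑ q : Perm (Fin m), ((Perm.sign q : ℤ) : ℂ) *
        ∏ i, kern η (v (Fin.natAdd n i)) (u (P (Fin.natAdd n (q i)))) := by
    rw [← Matrix.det_transpose, Matrix.det_apply']
    rfl
  rw [sectorDet, sectorDet, hd, Matrix.det_apply']
  simp only [mul_sum, sum_mul]
  rw [Finset.sum_comm]
  refine sum_congr rfl fun p _ => sum_congr rfl fun q _ => ?_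
  rw [sign_mul_blockPerm]
  simp only [Perm.mul_apply, blockPerm_castAdd, blockPerm_natAdd, Matrix.of_apply]
  have e1 : ∏ i : Fin n, ∏ j : Fin m,
      (u (P (Fin.natAdd n (q j))) - u (P (Fin.castAdd m (p i))) + η) =
      ∏ i : Fin n, ∏ j : Fin m, (u (P (Fin.natAdd n j)) - u (P (Fin.castAdd m i)) + η) := by
    rw [← Equiv.prod_comp p
      (fun i => ∏ j : Fin m, (u (P (Fin.natAdd n j)) - u (P (Fin.castAdd m i)) + η))]
    exact prod_congr rfl fun i _ =>
      Equiv.prod_comp q (fun j => u (P (Fin.natAdd n j)) - u (P (Fin.castAdd m (p i))) + η)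
  have e2 : ∏ i : Fin n, ∏ j : Fin n, (u (P (Fin.castAdd m (p i))) - v (Fin.castAdd m j) + η) =
      ∏ i : Fin n, ∏ j : Fin n, (u (P (Fin.castAdd m i)) - v (Fin.castAdd m j) + η) :=
    Equiv.prod_comp p
      (fun i => ∏ j : Fin n, (u (P (Fin.castAdd m i)) - v (Fin.castAdd m j) + η))
  have e3 : ∏ i : Fin m, ∏ j : Fin m, (v (Fin.natAdd n i) - u (P (Fin.natAdd n (q j))) + η) =
      ∏ i : Fin m, ∏ j : Fin m, (v (Fin.natAdd n i) - u (P (Fin.natAdd n j)) + η) :=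
    prod_congr rfl fun i _ =>
      Equiv.prod_comp q (fun j => v (Fin.natAdd n i) - u (P (Fin.natAdd n j)) + η)
  rw [e1, e2, e3]
  ring

/-- The sum over the permutations of the `u i`, evaluated by the partition identity. -/
theorem sum_sectorDet_eq_subsetTerm {n m : ℕ} {η : ℂ} {u v : Fin (n + m) → ℂ}
    (hu : Function.Injective u) (hv : Function.Injective v)
    (h0 : ∀ i j, u i - v j ≠ 0) (hp : ∀ i j, u i - v j + η ≠ 0) (hm : ∀ i j, v i - u j + η ≠ 0)
    (hvv : ∀ i j, v i - v j + η ≠ 0) :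
    ∑ P : Perm (Fin (n + m)), ((Perm.sign P : ℤ) : ℂ) * crossProd η (u ∘ P) v *
      (sectorDet η (fun i => v (Fin.castAdd m i)) (fun i => u (P (Fin.castAdd m i))) *
      sectorDet η (fun i => u (P (Fin.natAdd n i))) (fun i => v (Fin.natAdd n i))) =
    (n.factorial * m.factorial : ℂ) *
      subsetTerm η u v (univ.filter fun i : Fin (n + m) => i.val < n) := by
  set w : Fin (n + m) → ℂ := fun i => if i.val < n then v i else v i + η with hw
  have hwl : ∀ i : Fin n, w (Fin.castAdd m i) = v (Fin.castAdd m i) := fun i => by simp [hw]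
  have hwr : ∀ i : Fin m, w (Fin.natAdd n i) = v (Fin.natAdd n i) + η := fun i => by simp [hw]
  have hwinj : Function.Injective w := fun i j hij => by
    simp only [hw] at hij
    split_ifs at hij with h1 h2 h2
    · exact hv hij
    · exact absurd (by linear_combination -hij) (hvv j i)
    · exact absurd (by linear_combination hij) (hvv i j)
    · exact hv (add_right_cancel hij)
  have hw0 : ∀ i j, u i - w j ≠ 0 := fun i j h => by
    simp only [hw] at h
    split_ifs at h with h1
    · exact h0 i j h
    · exact hm j i (by linear_combination -h)
  have hw1 : ∀ i j, u i - w j + η ≠ 0 := fun i j h => by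
    simp only [hw] at h
    split_ifs at h with h1
    · exact hp i j h
    · exact h0 i j (by linear_combination h)
  have hne : ∏ i : Fin m, ∏ j : Fin n, (v (Fin.natAdd n i) - v (Fin.castAdd m j) + η) ≠ 0 :=
    prod_ne_zero_iff.2 fun i _ => prod_ne_zero_iff.2 fun j _ => hvv _ _
  have hker : ∀ i j, kern η (u j) (w i) =
      if i.val < n then kern η (u j) (v i) else kern η (v i) (u j) := fun i j => by
    simp only [hw]
    split_ifs
    · rfl
    · rw [kern, kern]; congr 1; ring
  have hlt : ∀ i : Fin m, ¬ (Fin.natAdd n i).val < n := fun i => by simp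
  have key := sum_split_eq_join η n u w hu hwinj hw0 hw1
  have hdet : ∑ P : Perm (Fin (n + m)), ((Perm.sign P : ℤ) : ℂ) * ∏ i, kern η (u (P i)) (w i) =
      (Matrix.of fun i j => if i ∈ (univ.filter fun i : Fin (n + m) => i.val < n)
        then kern η (u j) (v i) else kern η (v i) (u j)).det := by
    rw [← Matrix.det_transpose, Matrix.det_apply']
    refine sum_congr rfl fun P _ => ?_
    congr 1
    refine prod_congr rfl fun i _ => ?_
    rw [hker]; simp
  have hjoin : ∏ i, ∏ j, joinFactor η n w (u i) j = ∏ i, ∏ j,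
      if j ∈ (univ.filter fun i : Fin (n + m) => i.val < n) then u i - v j + η
        else v j - u i + η := by
    refine prod_congr rfl fun i _ => prod_congr rfl fun j _ => ?_
    simp only [joinFactor, hw, mem_filter, mem_univ, true_and]
    split_ifs
    · rfl
    · ring
  have hcr : (∏ i, ∏ j, if i ∉ (univ.filter fun i : Fin (n + m) => i.val < n) ∧
      j ∈ (univ.filter fun i : Fin (n + m) => i.val < n)
        then (v j - v i + η) / (v i - v j + η) else 1) =
      (∏ i : Fin n, ∏ j : Fin m, (v (Fin.castAdd m i) - v (Fin.natAdd n j) + η)) /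
        ∏ i : Fin m, ∏ j : Fin n, (v (Fin.natAdd n i) - v (Fin.castAdd m j) + η) := by
    rw [Finset.prod_comm (s := (univ : Finset (Fin n)))]
    have hlt' : ∀ i : Fin n, (Fin.castAdd m i).val < n := fun i => by simp
    simp only [Fin.prod_univ_add, mem_filter, mem_univ, true_and, hlt, hlt', not_true,
      not_false_eq_true,
      and_true, and_false, if_true, if_false, prod_const_one, prod_div_distrib,
      one_mul, mul_one]
  have hS := sum_sectorDet_mul_sectorDet (η := η) (u := u) (v := v)
  have e1 : ∀ P : Perm (Fin (n + m)), ((Perm.sign P : ℤ) : ℂ) * crossProd η (u ∘ P) v *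
      (sectorDet η (fun i => v (Fin.castAdd m i)) (fun i => u (P (Fin.castAdd m i))) *
      sectorDet η (fun i => u (P (Fin.natAdd n i))) (fun i => v (Fin.natAdd n i))) =
      (∏ i : Fin n, ∏ j : Fin m, (v (Fin.castAdd m i) - v (Fin.natAdd n j) + η)) *
      (((Perm.sign P : ℤ) : ℂ) *
      ((∏ i : Fin n, ∏ j : Fin m, (u (P (Fin.natAdd n j)) - u (P (Fin.castAdd m i)) + η)) *
      (sectorDet η (fun i => v (Fin.castAdd m i)) (fun i => u (P (Fin.castAdd m i))) *
      sectorDet η (fun i => u (P (Fin.natAdd n i))) (fun i => v (Fin.natAdd n i))))) := fun P => by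
    simp only [crossProd, prod_mul_distrib, Function.comp]
    ring
  have hsum : ∑ P : Perm (Fin (n + m)), ((Perm.sign P : ℤ) : ℂ) *
        ((∏ i, ∏ j, splitFactor η n (u ∘ P) w i j) * ∏ i, kern η (u (P i)) (w i)) =
      (∏ i : Fin m, ∏ j : Fin n, (v (Fin.natAdd n i) - v (Fin.castAdd m j) + η)) *
      ∑ P : Perm (Fin (n + m)), ((Perm.sign P : ℤ) : ℂ) *
      ((∏ i : Fin n, ∏ j : Fin m, (u (P (Fin.natAdd n j)) - u (P (Fin.castAdd m i)) + η)) *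
      (((∏ i : Fin n, ∏ j : Fin n, (u (P (Fin.castAdd m i)) - v (Fin.castAdd m j) + η)) *
        ∏ i : Fin n, kern η (u (P (Fin.castAdd m i))) (v (Fin.castAdd m i))) *
      ((∏ i : Fin m, ∏ j : Fin m, (v (Fin.natAdd n i) - u (P (Fin.natAdd n j)) + η)) *
        ∏ i : Fin m, kern η (v (Fin.natAdd n i)) (u (P (Fin.natAdd n i)))))) := by
    rw [mul_sum]
    refine sum_congr rfl fun P _ => ?_
    have hlt' : ∀ i : Fin n, (Fin.castAdd m i).val < n := fun i => by simp
    simp only [hker, Fin.prod_univ_add, splitFactor, hlt, hlt', if_true, if_false, hwl, hwr,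
      Function.comp, add_sub_right_comm, prod_mul_distrib]
    ring
  rw [subsetTerm, hcr, ← hjoin, ← hdet, sum_congr rfl fun P _ => e1 P, ← mul_sum, hS,
    mul_right_comm (∏ i, ∏ j, joinFactor η n w (u i) j), ← key, hsum]
  field_simp

/-! ### Resummation over subsets -/

/-- The subset term is covariant under permutations of the `v i`. -/
theorem sign_mul_subsetTerm {M : ℕ} (η : ℂ) (u v : Fin M → ℂ) (Q : Perm (Fin M))
    (J : Finset (Fin M)) :
    ((Perm.sign Q : ℤ) : ℂ) * subsetTerm η u (v ∘ Q) J = subsetTerm η u v (J.image Q) := by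
  have hmem : ∀ i, Q i ∈ J.image Q ↔ i ∈ J := fun i => by simp
  have hdet : ((Perm.sign Q : ℤ) : ℂ) *
      (Matrix.of fun i j => if i ∈ J then kern η (u j) ((v ∘ Q) i) else kern η ((v ∘ Q) i) (u j)).det =
      (Matrix.of fun i j => if i ∈ J.image Q then kern η (u j) (v i)
        else kern η (v i) (u j)).det := by
    have h : (Matrix.of fun i j => if i ∈ J then kern η (u j) ((v ∘ Q) i)
        else kern η ((v ∘ Q) i) (u j)) = (Matrix.of fun i j =>
          if i ∈ J.image Q then kern η (u j) (v i) else kern η (v i) (u j)).submatrix Q id := by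
      ext i j
      simp
    rw [h, Matrix.det_permute, ← mul_assoc]
    rcases Int.units_eq_one_or (Perm.sign Q) with h | h <;> simp [h]
  have h1 : (∏ i, ∏ j, if j ∈ J then u i - (v ∘ Q) j + η else (v ∘ Q) j - u i + η) =
      ∏ i, ∏ j, if j ∈ J.image Q then u i - v j + η else v j - u i + η := by
    refine prod_congr rfl fun i _ => ?_
    rw [← Equiv.prod_comp Q
      (fun j => if j ∈ J.image Q then u i - v j + η else v j - u i + η)]
    exact prod_congr rfl fun j _ => by simp only [hmem, Function.comp]
  have h2 : (∏ i, ∏ j, if i ∉ J ∧ j ∈ J then ((v ∘ Q) j - (v ∘ Q) i + η) /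
        ((v ∘ Q) i - (v ∘ Q) j + η) else 1) =
      ∏ i, ∏ j, if i ∉ J.image Q ∧ j ∈ J.image Q then (v j - v i + η) / (v i - v j + η) else 1 := by
    rw [← Equiv.prod_comp Q (fun i => ∏ j, if i ∉ J.image Q ∧ j ∈ J.image Q then
      (v j - v i + η) / (v i - v j + η) else 1)]
    refine prod_congr rfl fun i _ => ?_
    rw [← Equiv.prod_comp Q (fun j => if Q i ∉ J.image Q ∧ j ∈ J.image Q then
      (v j - v (Q i) + η) / (v (Q i) - v j + η) else 1)]
    exact prod_congr rfl fun j _ => by simp only [hmem, Function.comp]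
  rw [subsetTerm, subsetTerm, ← hdet, h1, h2]
  ring

/-- The sum over both permutations, as a sum over the sets of `v i` on the negative half-line. -/
theorem sum_sum_sectorDet_eq {n m : ℕ} {η : ℂ} {u v : Fin (n + m) → ℂ}
    (hu : Function.Injective u) (hv : Function.Injective v)
    (h0 : ∀ i j, u i - v j ≠ 0) (hp : ∀ i j, u i - v j + η ≠ 0) (hm : ∀ i j, v i - u j + η ≠ 0)
    (hvv : ∀ i j, v i - v j + η ≠ 0) :
    ∑ P : Perm (Fin (n + m)), ∑ Q : Perm (Fin (n + m)),
      ((Perm.sign P : ℤ) : ℂ) * ((Perm.sign Q : ℤ) : ℂ) * crossProd (n := n) (m := m) η (u ∘ P) (v ∘ Q) *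
      (sectorDet η (fun i => v (Q (Fin.castAdd m i))) (fun i => u (P (Fin.castAdd m i))) *
      sectorDet η (fun i => u (P (Fin.natAdd n i))) (fun i => v (Q (Fin.natAdd n i)))) =
    (n.factorial * m.factorial : ℂ) ^ 2 * ∑ J ∈ powersetCard n univ, subsetTerm η u v J := by
  rw [pow_two, mul_assoc, ← sum_perm_image, Finset.sum_comm, mul_sum]
  refine sum_congr rfl fun Q _ => ?_
  have h := sum_sectorDet_eq_subsetTerm (n := n) (m := m) (v := v ∘ Q) hu
    (hv.comp Q.injective) (fun i j => h0 i _) (fun i j => hp i _) (fun i j => hm _ j)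
    (fun i j => hvv _ _)
  rw [← sign_mul_subsetTerm, mul_left_comm, ← h, mul_sum]
  refine sum_congr rfl fun P _ => ?_
  simp only [Function.comp]
  ring

/-- The sum over all subsets is the expansion of a single determinant along its rows. -/
theorem sum_pow_mul_subsetTerm {M : ℕ} {η : ℂ} (κ : ℂ) {u v : Fin M → ℂ}
    (hp : ∀ i j, u i - v j + η ≠ 0) (hvv : ∀ i j, v i - v j + η ≠ 0) :
    ∑ n ∈ range (M + 1), κ ^ n * ∑ J ∈ powersetCard n univ, subsetTerm η u v J =
      (∏ i, ∏ j, (u i - v j + η)) * (Matrix.of fun i j => kern η (v i) (u j) *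
        ((∏ k, (v i - u k + η) / (u k - v i + η)) * ∏ k, (v k - v i + η) / (v i - v k + η)) +
        κ * kern η (u j) (v i)).det := by
  classical
  set a : Fin M → ℂ := fun i =>
    (∏ k, (v i - u k + η) / (u k - v i + η)) * ∏ k, (v k - v i + η) / (v i - v k + η) with ha
  have hexp : (Matrix.of fun i j => kern η (v i) (u j) * a i + κ * kern η (u j) (v i)).det =
      ∑ J : Finset (Fin M), (∏ i, if i ∈ J then κ else a i) *
        (Matrix.of fun i j => if i ∈ J then kern η (u j) (v i) else kern η (v i) (u j)).det := by
    have h1 := (Matrix.detRowAlternating (n := Fin M) (R := ℂ)).toMultilinearMap.map_add_univ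
      (fun i j => κ * kern η (u j) (v i)) (fun i j => kern η (v i) (u j) * a i)
    have h2 : (Matrix.of fun i j => kern η (v i) (u j) * a i + κ * kern η (u j) (v i)).det =
        (Matrix.detRowAlternating (n := Fin M) (R := ℂ)).toMultilinearMap
          ((fun i j => κ * kern η (u j) (v i)) + (fun i j => kern η (v i) (u j) * a i)) := by
      change _ = Matrix.det _
      congr 1
      ext i j
      exact add_comm _ _
    rw [h2, h1]
    refine sum_congr rfl fun J _ => ?_
    rw [← Matrix.det_mul_column]
    change Matrix.det _ = _
    congr 1
    ext i j
    by_cases h : i ∈ J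
    · simp [h]
    · simp [h, mul_comm]
  have hpow := sum_powerset (univ : Finset (Fin M)) (fun J => κ ^ #J * subsetTerm η u v J)
  rw [card_univ, Fintype.card_fin, powerset_univ] at hpow
  have hl : ∑ n ∈ range (M + 1), κ ^ n * ∑ J ∈ powersetCard n univ, subsetTerm η u v J =
      ∑ J : Finset (Fin M), κ ^ #J * subsetTerm η u v J := by
    rw [hpow]
    refine sum_congr rfl fun n _ => ?_
    rw [mul_sum]
    exact sum_congr rfl fun J hJ => by rw [(mem_powersetCard.1 hJ).2]
  rw [hl, hexp, mul_sum]
  refine sum_congr rfl fun J _ => ?_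
  rw [subsetTerm, ← mul_assoc, ← mul_assoc, ← mul_assoc]
  congr 1
  have e1 : ∏ i, (if i ∈ J then κ else a i) = κ ^ #J * ∏ i, if i ∈ J then 1 else a i := by
    rw [prod_ite, prod_ite]
    simp
  have e2 : (∏ i, if i ∈ J then 1 else a i) =
      (∏ i, ∏ k, if i ∈ J then 1 else (v i - u k + η) / (u k - v i + η)) *
      ∏ i, ∏ k, if i ∈ J then 1 else (v k - v i + η) / (v i - v k + η) := by
    rw [← prod_mul_distrib]
    refine prod_congr rfl fun i _ => ?_
    by_cases h : i ∈ J <;> simp [h, ha]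
  have e3 : (∏ i, ∏ j, (u i - v j + η)) *
      (∏ i, ∏ k, if i ∈ J then 1 else (v i - u k + η) / (u k - v i + η)) =
      ∏ i, ∏ j, if j ∈ J then u i - v j + η else v j - u i + η := by
    rw [Finset.prod_comm (f := fun i j => u i - v j + η),
      Finset.prod_comm (f := fun i j => if j ∈ J then u i - v j + η else v j - u i + η),
      ← prod_mul_distrib]
    refine prod_congr rfl fun j _ => ?_
    rw [← prod_mul_distrib]
    refine prod_congr rfl fun i _ => ?_
    split_ifs
    · rw [mul_one]
    · rw [mul_div_cancel₀ _ (hp i j)]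
  have e4 : (∏ i, ∏ k, if i ∈ J then 1 else (v k - v i + η) / (v i - v k + η)) =
      (∏ i, ∏ j, if i ∉ J ∧ j ∈ J then (v j - v i + η) / (v i - v j + η) else 1) := by
    -- the pairs inside the complement of `J` cancel
    have h1 : ∏ i, ∏ k, (if i ∉ J ∧ k ∉ J then (v k - v i + η) / (v i - v k + η) else 1) = 1 := by
      have h2 : ∏ i, ∏ k, (if i ∉ J ∧ k ∉ J then (v k - v i + η) / (v i - v k + η) else 1) =
          (∏ i, ∏ k, if i ∉ J ∧ k ∉ J then v k - v i + η else 1) /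
          ∏ i, ∏ k, if i ∉ J ∧ k ∉ J then v i - v k + η else 1 := by
        rw [← prod_div_distrib]
        refine prod_congr rfl fun i _ => ?_
        rw [← prod_div_distrib]
        exact prod_congr rfl fun k _ => by split_ifs <;> simp
      rw [h2, Finset.prod_comm]
      simp only [and_comm]
      refine div_self (prod_ne_zero_iff.2 fun i _ => prod_ne_zero_iff.2 fun k _ => ?_)
      split_ifs
      · exact hvv _ _
      · exact one_ne_zero
    refine Eq.trans ?_ ((congrArg _ h1).trans (mul_one _))
    rw [← prod_mul_distrib]
    refine prod_congr rfl fun i _ => ?_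
    rw [← prod_mul_distrib]
    refine prod_congr rfl fun k _ => ?_
    by_cases hi : i ∈ J <;> by_cases hk : k ∈ J <;> simp [hi, hk]
  rw [e1, e2, ← e3, ← e4]
  ring

/-! ### Integrals of exponentials over ordered sectors -/

theorem tailProd_const_mul {n : ℕ} (a : ℂ) (d : Fin n → ℂ) :
    tailProd (fun k => a * d k) = a⁻¹ ^ n * tailProd d := by
  induction n with
  | zero => simp [tailProd]
  | succ n ih =>
    have : (fun k => a * d k) ∘ Fin.succ = fun k => a * (d ∘ Fin.succ) k := rfl
    rw [tailProd, tailProd, this, ih, ← mul_sum, mul_inv, pow_succ]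
    ring

theorem measurableSet_D (n : ℕ) : MeasurableSet (D n) := by
  have : D n = ⋂ i, ⋂ j, {x : Fin n → ℝ | i < j → x i < x j} := by
    ext; simp [D]
  rw [this]
  refine MeasurableSet.iInter fun i => MeasurableSet.iInter fun j => ?_
  by_cases h : i < j
  · simpa [h] using measurableSet_lt (measurable_pi_apply i) (measurable_pi_apply j)
  · simp [h]

/-- The ordered sector `a < x_1 < ⋯ < x_n`. -/
def sectorAbove (n : ℕ) (a : ℝ) : Set (Fin n → ℝ) := {x | ∀ i, a < x i} ∩ D n

theorem measurableSet_sectorAbove (n : ℕ) (a : ℝ) : MeasurableSet (sectorAbove n a) := by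
  refine MeasurableSet.inter ?_ (measurableSet_D n)
  simp only [Set.ofPred_forall]
  exact MeasurableSet.iInter fun i => measurableSet_lt measurable_const (measurable_pi_apply i)

/-- The ordered sectors are nested, so that the particles can be integrated out one by one. -/
theorem cons_mem_sectorAbove {n : ℕ} {a x : ℝ} {y : Fin n → ℝ} :
    (Fin.cons x y : Fin (n + 1) → ℝ) ∈ sectorAbove (n + 1) a ↔
      a < x ∧ y ∈ sectorAbove n x := by
  simp only [sectorAbove, D, Set.mem_inter_iff, Set.mem_ofPred_eq, Fin.forall_fin_succ, Fin.cons_zero,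
    Fin.cons_succ, Fin.succ_lt_succ_iff, Fin.succ_pos, Fin.not_lt_zero, false_imp_iff,
    true_imp_iff, true_and]
  constructor
  · rintro ⟨⟨h1, h2⟩, h3, h4⟩
    exact ⟨h1, h3, h4⟩
  · rintro ⟨h1, h3, h4⟩
    exact ⟨⟨h1, fun i => h1.trans (h3 i)⟩, h3, h4⟩

/-- Domination by the orthant, where the exponential is a product of integrable functions. -/
theorem integrableOn_exp_sectorAbove {n : ℕ} (a : ℝ) {z : Fin n → ℂ} (hz : ∀ i, 0 < (z i).re) :
    IntegrableOn (fun x : Fin n → ℝ => Complex.exp (-∑ i, z i * x i)) (sectorAbove n a) := by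
  have h1 : ∀ i, Integrable ((Set.Ioi a).indicator fun t : ℝ => Complex.exp (-z i * t)) :=
    fun i => (integrable_indicator_iff measurableSet_Ioi).2
      (integrableOn_exp_mul_complex_Ioi (by simpa using hz i) a)
  have h2 := Integrable.fintype_prod (μ := fun _ : Fin n => (volume : Measure ℝ)) h1
  rw [← volume_pi] at h2
  have hm : MeasurableSet (Set.univ.pi fun _ : Fin n => Set.Ioi a) :=
    MeasurableSet.univ_pi fun _ => measurableSet_Ioi
  have h3 : IntegrableOn (fun x : Fin n → ℝ => Complex.exp (-∑ i, z i * x i))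
      (Set.univ.pi fun _ : Fin n => Set.Ioi a) := by
    rw [← integrable_indicator_iff hm]
    refine h2.congr (Eventually.of_forall fun x => ?_)
    simp only
    by_cases hx : x ∈ Set.univ.pi fun _ : Fin n => Set.Ioi a
    · rw [Set.indicator_of_mem hx, ← sum_neg_distrib, Complex.exp_sum]
      refine prod_congr rfl fun i _ => ?_
      rw [Set.indicator_of_mem (hx i (Set.mem_univ i)), neg_mul]
    · rw [Set.indicator_of_notMem hx]
      obtain ⟨i, hi⟩ : ∃ i, x i ∉ Set.Ioi a := by
        by_contra! h
        exact hx fun i _ => h i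
      exact prod_eq_zero (mem_univ i) (Set.indicator_of_notMem hi _)
  exact h3.mono_set fun x hx i _ => hx.1 i

/-- Exponentials integrate over an ordered sector to a product of inverse partial sums. -/
theorem integral_exp_sectorAbove {n : ℕ} (a : ℝ) {z : Fin n → ℂ} (hz : ∀ i, 0 < (z i).re) :
    ∫ x in sectorAbove n a, Complex.exp (-∑ i, z i * x i) =
      Complex.exp (-(∑ i, z i) * a) * tailProd z := by
  induction n generalizing a with
  | zero =>
    have : sectorAbove 0 a = Set.univ := by
      ext; simp [sectorAbove, D]
    rw [this]
    simp [tailProd, volume_pi, measureReal_def]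
  | succ n ih =>
    have hmp := (volume_preserving_piFinSuccAbove (fun _ : Fin (n + 1) => ℝ) 0).symm
    have hind := (integrable_indicator_iff (measurableSet_sectorAbove (n + 1) a)).2
      (integrableOn_exp_sectorAbove a hz)
    have hind2 := (hmp.integrable_comp_emb (MeasurableEquiv.measurableEmbedding _)).2 hind
    rw [← integral_indicator (measurableSet_sectorAbove _ _),
      ← hmp.integral_comp (MeasurableEquiv.measurableEmbedding _)]
    rw [Measure.volume_eq_prod] at hind2 ⊢
    refine (integral_prod _ hind2).trans ?_
    simp only [Function.comp]
    have hcons : ∀ (x : ℝ) (y : Fin n → ℝ),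
        (MeasurableEquiv.piFinSuccAbove (fun _ : Fin (n + 1) => ℝ) 0).symm (x, y) =
          (Fin.cons x y : Fin (n + 1) → ℝ) := fun x y => by
      ext i; simp [MeasurableEquiv.piFinSuccAbove]
    have hin : ∀ x : ℝ, (∫ y : Fin n → ℝ, (sectorAbove (n + 1) a).indicator
        (fun x : Fin (n + 1) → ℝ => Complex.exp (-∑ i, z i * x i))
        ((MeasurableEquiv.piFinSuccAbove (fun _ : Fin (n + 1) => ℝ) 0).symm (x, y))) =
        (Set.Ioi a).indicator (fun x : ℝ => Complex.exp (-(∑ i, z i) * x) *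
          tailProd (z ∘ Fin.succ)) x := fun x => by
      by_cases hx : x ∈ Set.Ioi a
      · rw [Set.indicator_of_mem hx]
        have h1 := ih x (z := z ∘ Fin.succ) fun i => hz _
        have h2 : Complex.exp (-(∑ i, z i) * x) * tailProd (z ∘ Fin.succ) =
            Complex.exp (-(z 0 * x)) * (Complex.exp (-(∑ i, (z ∘ Fin.succ) i) * x) *
              tailProd (z ∘ Fin.succ)) := by
          rw [← mul_assoc, ← Complex.exp_add, Fin.sum_univ_succ]
          congr 2
          simp only [Function.comp]
          ring
        rw [h2, ← h1, ← integral_const_mul, ← integral_indicator (measurableSet_sectorAbove _ _)]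
        congr 1
        ext y
        rw [hcons]
        by_cases hy : y ∈ sectorAbove n x
        · rw [Set.indicator_of_mem hy, Set.indicator_of_mem (cons_mem_sectorAbove.2 ⟨hx, hy⟩),
            ← Complex.exp_add, Fin.sum_univ_succ]
          simp [add_comm]
        · rw [Set.indicator_of_notMem hy,
            Set.indicator_of_notMem fun h => hy (cons_mem_sectorAbove.1 h).2]
      · rw [Set.indicator_of_notMem hx]
        refine integral_eq_zero_of_ae (Eventually.of_forall fun y => ?_)
        simp only [hcons, Pi.zero_apply]
        exact Set.indicator_of_notMem (fun h => hx (cons_mem_sectorAbove.1 h).1) _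
    simp_rw [hin]
    have hre : (-(∑ i, z i)).re < 0 := by
      rw [Complex.neg_re, Complex.re_sum, neg_lt_zero]
      exact sum_pos (fun i _ => hz i) univ_nonempty
    rw [integral_indicator measurableSet_Ioi, integral_mul_const,
      integral_exp_mul_complex_Ioi hre, tailProd]
    rw [neg_div_neg_eq, div_eq_mul_inv, mul_assoc]

/-- The ordered sector `x_1 < ⋯ < x_n < 0`. -/
def sectorNeg (n : ℕ) : Set (Fin n → ℝ) := {x | ∀ i, x i < 0} ∩ D n

/-- The reflection `x ↦ -x` of the configurations, with the particles listed in reverse order. -/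
def reflect (n : ℕ) : (Fin n → ℝ) ≃ᵐ (Fin n → ℝ) :=
  (MeasurableEquiv.piCongrLeft (fun _ : Fin n => ℝ) Fin.revPerm).trans (MeasurableEquiv.neg _)

theorem reflect_apply {n : ℕ} (x : Fin n → ℝ) (i : Fin n) : reflect n x i = - x i.rev := by
  have := Equiv.piCongrLeft_apply_apply (fun _ : Fin n => ℝ) Fin.revPerm x i.rev
  simp only [Fin.revPerm_apply, Fin.rev_rev] at this
  rw [← this]
  rfl

theorem measurePreserving_reflect (n : ℕ) : MeasurePreserving (reflect n) :=
  (volume_measurePreserving_piCongrLeft (fun _ : Fin n => ℝ) Fin.revPerm).trans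
    (Measure.measurePreserving_neg _)

theorem reflect_mem_sectorAbove {n : ℕ} {x : Fin n → ℝ} :
    reflect n x ∈ sectorAbove n 0 ↔ x ∈ sectorNeg n := by
  simp only [sectorAbove, sectorNeg, D, Set.mem_inter_iff, Set.mem_ofPred_eq, reflect_apply,
    Left.neg_pos_iff, neg_lt_neg_iff]
  refine and_congr ⟨fun h i => by simpa using h i.rev, fun h i => h _⟩
    ⟨fun h i j hij => by simpa using h j.rev i.rev (Fin.rev_lt_rev.2 hij),
      fun h i j hij => h _ _ (Fin.rev_lt_rev.2 hij)⟩

theorem measurableSet_sectorNeg (n : ℕ) : MeasurableSet (sectorNeg n) := by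
  have : sectorNeg n = reflect n ⁻¹' sectorAbove n 0 := by
    ext x; exact reflect_mem_sectorAbove.symm
  rw [this]
  exact (reflect n).measurable (measurableSet_sectorAbove n 0)

theorem exp_reflect {n : ℕ} (z : Fin n → ℂ) (x : Fin n → ℝ) :
    Complex.exp (-∑ i, z i.rev * (reflect n x i : ℝ)) = Complex.exp (∑ i, z i * x i) := by
  rw [← sum_neg_distrib, ← Equiv.sum_comp Fin.revPerm]
  congr 1
  refine sum_congr rfl fun i _ => ?_
  rw [reflect_apply]
  simp

theorem integrableOn_exp_sectorNeg {n : ℕ} {z : Fin n → ℂ} (hz : ∀ i, 0 < (z i).re) :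
    IntegrableOn (fun x : Fin n → ℝ => Complex.exp (∑ i, z i * x i)) (sectorNeg n) := by
  have h := integrableOn_exp_sectorAbove 0 (z := fun i => z i.rev) fun i => hz _
  have h2 := ((measurePreserving_reflect n).integrableOn_comp_preimage
    (reflect n).measurableEmbedding).2 h
  have : sectorNeg n = reflect n ⁻¹' sectorAbove n 0 := by
    ext x; exact reflect_mem_sectorAbove.symm
  rw [this]
  refine h2.congr_fun (fun x _ => exp_reflect z x) ?_
  exact (reflect n).measurable (measurableSet_sectorAbove n 0)

theorem integral_exp_sectorNeg {n : ℕ} {z : Fin n → ℂ} (hz : ∀ i, 0 < (z i).re) :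
    ∫ x in sectorNeg n, Complex.exp (∑ i, z i * x i) = tailProd (fun i => z i.rev) := by
  have h := integral_exp_sectorAbove 0 (z := fun i => z i.rev) fun i => hz _
  rw [Complex.ofReal_zero, mul_zero, Complex.exp_zero, one_mul] at h
  have h2 := (measurePreserving_reflect n).setIntegral_preimage_emb (reflect n).measurableEmbedding
    (fun x : Fin n → ℝ => Complex.exp (-∑ i, z i.rev * x i)) (sectorAbove n 0)
  have : sectorNeg n = reflect n ⁻¹' sectorAbove n 0 := by
    ext x; exact reflect_mem_sectorAbove.symm
  rw [← h, ← h2, this]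
  exact integral_congr_ae (Eventually.of_forall fun x => (exp_reflect z x).symm)

/-- The part of `D (n + m)` with `n` negative and `m` positive coordinates. -/
def twoSector (n m : ℕ) : Set (Fin (n + m) → ℝ) :=
  {x | (fun i => x (Fin.castAdd m i)) ∈ sectorNeg n ∧
    (fun i => x (Fin.natAdd n i)) ∈ sectorAbove m 0}

/-- The coordinates of the first `n` and of the last `m` particles. -/
def splitEquiv (n m : ℕ) : (Fin (n + m) → ℝ) ≃ᵐ (Fin n → ℝ) × (Fin m → ℝ) :=
  (MeasurableEquiv.piCongrLeft (fun _ : Fin (n + m) => ℝ) finSumFinEquiv).symm.trans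
    (MeasurableEquiv.sumPiEquivProdPi fun _ => ℝ)

theorem measurePreserving_splitEquiv (n m : ℕ) : MeasurePreserving (splitEquiv n m) :=
  (volume_measurePreserving_piCongrLeft (fun _ : Fin (n + m) => ℝ) finSumFinEquiv).symm.trans
    (volume_measurePreserving_sumPiEquivProdPi fun _ => ℝ)

theorem twoSector_eq_preimage (n m : ℕ) :
    twoSector n m = splitEquiv n m ⁻¹' (sectorNeg n ×ˢ sectorAbove m 0) := by
  ext x; rfl

theorem measurableSet_twoSector (n m : ℕ) : MeasurableSet (twoSector n m) := by
  rw [twoSector_eq_preimage]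
  exact (splitEquiv n m).measurable
    ((measurableSet_sectorNeg n).prod (measurableSet_sectorAbove m 0))

theorem integrableOn_exp_twoSector {n m : ℕ} {a : Fin n → ℂ} {b : Fin m → ℂ}
    (ha : ∀ i, 0 < (a i).re) (hb : ∀ i, 0 < (b i).re) :
    IntegrableOn (fun x : Fin (n + m) → ℝ => Complex.exp (∑ i, a i * x (Fin.castAdd m i)) *
      Complex.exp (-∑ i, b i * x (Fin.natAdd n i))) (twoSector n m) := by
  have h : IntegrableOn (fun p : (Fin n → ℝ) × (Fin m → ℝ) => Complex.exp (∑ i, a i * p.1 i) *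
      Complex.exp (-∑ i, b i * p.2 i)) (sectorNeg n ×ˢ sectorAbove m 0) := by
    rw [IntegrableOn, Measure.volume_eq_prod, ← Measure.prod_restrict]
    exact Integrable.mul_prod (integrableOn_exp_sectorNeg ha) (integrableOn_exp_sectorAbove 0 hb)
  rw [twoSector_eq_preimage]
  exact ((measurePreserving_splitEquiv n m).integrableOn_comp_preimage
    (splitEquiv n m).measurableEmbedding).2 h

theorem integral_exp_twoSector {n m : ℕ} {a : Fin n → ℂ} {b : Fin m → ℂ}
    (ha : ∀ i, 0 < (a i).re) (hb : ∀ i, 0 < (b i).re) :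
    ∫ x in twoSector n m, Complex.exp (∑ i, a i * x (Fin.castAdd m i)) *
      Complex.exp (-∑ i, b i * x (Fin.natAdd n i)) =
      tailProd (fun i => a i.rev) * tailProd b := by
  have h1 := (measurePreserving_splitEquiv n m).setIntegral_preimage_emb
    (splitEquiv n m).measurableEmbedding
    (fun p : (Fin n → ℝ) × (Fin m → ℝ) => Complex.exp (∑ i, a i * p.1 i) *
      Complex.exp (-∑ i, b i * p.2 i)) (sectorNeg n ×ˢ sectorAbove m 0)
  rw [← twoSector_eq_preimage] at h1
  refine h1.trans ?_
  have h2 := integral_exp_sectorAbove 0 hb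
  rw [Complex.ofReal_zero, mul_zero, Complex.exp_zero, one_mul] at h2
  rw [Measure.volume_eq_prod, ← integral_exp_sectorNeg ha, ← h2]
  exact setIntegral_prod_mul (fun x : Fin n → ℝ => Complex.exp (∑ i, a i * x i))
    (fun x : Fin m → ℝ => Complex.exp (-∑ i, b i * x i)) _ _

/-! ### Decomposition of the domain and of the integrand -/

/-- The configurations in `D M` whose first `n` coordinates are negative and whose other
coordinates are positive. -/
def signSector (M n : ℕ) : Set (Fin M → ℝ) :=
  {x | (∀ i : Fin M, i.val < n → x i < 0) ∧ ∀ i : Fin M, n ≤ i.val → 0 < x i} ∩ D M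

theorem signSector_add (n m : ℕ) : signSector (n + m) n = twoSector n m := by
  ext x
  simp only [signSector, twoSector, sectorNeg, sectorAbove, D, Set.mem_inter_iff,
    Set.mem_ofPred_eq]
  constructor
  · rintro ⟨⟨h1, h2⟩, h3⟩
    refine ⟨⟨fun i => h1 _ (by simp), fun i j hij => h3 _ _ ?_⟩,
      fun i => h2 _ (by simp), fun i j hij => h3 _ _ ?_⟩
    · exact hij
    · rw [Fin.lt_def] at hij ⊢
      simpa using hij
  · rintro ⟨⟨h1, h2⟩, h3, h4⟩
    refine ⟨⟨fun i hi => ?_, fun i hi => ?_⟩, fun i j hij => ?_⟩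
    · induction i using Fin.addCases with
      | left i => exact h1 i
      | right i => simp at hi
    · induction i using Fin.addCases with
      | left i => simp at hi; omega
      | right i => exact h3 i
    · induction i using Fin.addCases with
      | left i =>
        induction j using Fin.addCases with
        | left j => exact h2 i j hij
        | right j => exact (h1 i).trans (h3 j)
      | right i =>
        induction j using Fin.addCases with
        | left j => rw [Fin.lt_def] at hij; simp at hij; omega
        | right j => exact h4 i j (by rw [Fin.lt_def] at hij ⊢; simpa using hij)

theorem measurableSet_signSector (M n : ℕ) : MeasurableSet (signSector M n) := by
  refine MeasurableSet.inter ?_ (measurableSet_D M)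
  have : {x : Fin M → ℝ | (∀ i : Fin M, i.val < n → x i < 0) ∧ ∀ i : Fin M, n ≤ i.val → 0 < x i} =
      (⋂ i : Fin M, {x | i.val < n → x i < 0}) ∩ ⋂ i : Fin M, {x | n ≤ i.val → 0 < x i} := by
    ext; simp
  rw [this]
  refine (MeasurableSet.iInter fun i => ?_).inter (MeasurableSet.iInter fun i => ?_)
  · by_cases h : i.val < n
    · simpa [h] using measurableSet_lt (measurable_pi_apply i) measurable_const
    · simp [h]
  · by_cases h : n ≤ i.val
    · simpa [h] using measurableSet_lt measurable_const (measurable_pi_apply i)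
    · simp [h]

theorem pairwiseDisjoint_signSector (M : ℕ) :
    (range (M + 1) : Set ℕ).PairwiseDisjoint (signSector M) := by
  have key : ∀ n k, n < k → k < M + 1 → ∀ x, x ∈ signSector M n → x ∉ signSector M k :=
    fun n k hnk hk x hx hx' => by
      have h1 := hx.1.2 ⟨n, by omega⟩ le_rfl
      have h2 := hx'.1.1 ⟨n, by omega⟩ hnk
      exact lt_asymm h1 h2
  intro n hn k hk hnk
  have hn' := mem_range.1 (mem_coe.1 hn)
  have hk' := mem_range.1 (mem_coe.1 hk)
  refine Set.disjoint_left.2 fun x hx hx' => ?_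
  rcases lt_or_gt_of_ne hnk with h | h
  · exact key n k h hk' x hx hx'
  · exact key k n h hn' x hx' hx

/-- Up to the null set where a coordinate vanishes, `D M` is the union of the sectors with a fixed
number of negative coordinates. -/
theorem D_ae_eq_iUnion_signSector (M : ℕ) :
    D M =ᵐ[volume] ⋃ n ∈ range (M + 1), signSector M n := by
  have h0 : ∀ᵐ x : Fin M → ℝ, ∀ i, x i ≠ 0 :=
    ae_all_iff.2 fun i => Measure.ae_eval_ne (μ := fun _ : Fin M => (volume : Measure ℝ)) i 0
  filter_upwards [h0] with x hx
  refine propext ⟨fun hD => ?_, fun h => ?_⟩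
  · have hmono : ∀ i j, i ≤ j → x i ≤ x j := fun i j hij => by
      rcases hij.eq_or_lt with rfl | h
      · exact le_rfl
      · exact (hD i j h).le
    set S := univ.filter fun i => x i < 0 with hS
    refine Set.mem_iUnion₂.2 ⟨#S, ?_, ⟨fun i hi => ?_, fun i hi => ?_⟩, hD⟩
    · rw [mem_range, Nat.lt_succ_iff]
      exact (card_le_univ S).trans_eq (Fintype.card_fin M)
    · by_contra h
      have : S ⊆ Iio i := fun j hj => by
        rw [mem_Iio]
        by_contra hij
        exact h ((hmono i j (not_lt.1 hij)).trans_lt (mem_filter.1 hj).2)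
      have := card_le_card this
      rw [Fin.card_Iio] at this
      omega
    · by_contra h
      have hneg : x i < 0 := lt_of_le_of_ne (not_lt.1 h) (hx i)
      have : Iic i ⊆ S := fun j hj =>
        mem_filter.2 ⟨mem_univ j, (hmono j i (mem_Iic.1 hj)).trans_lt hneg⟩
      have := card_le_card this
      rw [Fin.card_Iic] at this
      omega
  · obtain ⟨n, _, hn⟩ := Set.mem_iUnion₂.1 h
    exact hn.2

/-- The Bethe sum in terms of the inverse permutations. -/
theorem betheSum_eq {M : ℕ} (c : ℝ) (w x : Fin M → ℝ) :
    betheSum c w x = ∑ P : Perm (Fin M),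
      F c (w ∘ P) * Complex.exp (Complex.I * ∑ i, (w (P i) : ℂ) * x i) := by
  rw [betheSum, ← Equiv.sum_comp (Equiv.inv (Perm (Fin M)))]
  refine sum_congr rfl fun P _ => ?_
  have : permute (P⁻¹) w = w ∘ P := by
    ext i; simp [permute]
  rw [Equiv.inv_apply, this]
  simp

/-- The amplitudes with the Vandermonde denominator, which is antisymmetric, pulled out. -/
theorem F_comp_perm {M : ℕ} (c : ℝ) {w : Fin M → ℝ} (hw : Function.Injective w)
    (P : Perm (Fin M)) :
    F c (w ∘ P) = ((Perm.sign P : ℤ) : ℂ) *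
      pairProd (fun x y => x - y + Complex.I * c) ((fun i => (w i : ℂ)) ∘ P) /
        pairProd (fun x y => x - y) (fun i => (w i : ℂ)) := by
  have h1 : F c (w ∘ P) = pairProd (fun x y => (x - y + Complex.I * c) / (x - y))
      ((fun i => (w i : ℂ)) ∘ P) := by
    rw [F, pairProd_eq_Ioi]
    refine prod_congr rfl fun i _ => prod_congr rfl fun j hj => ?_
    have hne : (w (P i) : ℂ) - w (P j) ≠ 0 := by
      rw [sub_ne_zero, Ne, Complex.ofReal_inj]
      exact fun h => (mem_Ioi.1 hj).ne (P.injective (hw h))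
    simp only [f, g, Function.comp]
    field_simp
  rw [h1, pairProd_div, pairProd_sub_rev]
  rcases Int.units_eq_one_or (Perm.sign P) with h | h <;> simp [h, div_neg, neg_div]

theorem conj_F_comp_perm {M : ℕ} (c : ℝ) {w : Fin M → ℝ} (hw : Function.Injective w)
    (P : Perm (Fin M)) :
    (starRingEnd ℂ) (F c (w ∘ P)) = ((Perm.sign P : ℤ) : ℂ) *
      pairProd (fun x y => y - x + Complex.I * c) ((fun i => (w i : ℂ)) ∘ P) /
        pairProd (fun x y => y - x) (fun i => (w i : ℂ)) := by
  have h1 : (starRingEnd ℂ) (F c (w ∘ P)) =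
      pairProd (fun x y => (y - x + Complex.I * c) / (y - x)) ((fun i => (w i : ℂ)) ∘ P) := by
    rw [F, pairProd_eq_Ioi, map_prod]
    refine prod_congr rfl fun i _ => ?_
    rw [map_prod]
    refine prod_congr rfl fun j hj => ?_
    have hne : (w (P i) : ℂ) - w (P j) ≠ 0 := by
      rw [sub_ne_zero, Ne, Complex.ofReal_inj]
      exact fun h => (mem_Ioi.1 hj).ne (P.injective (hw h))
    have hne' : (w (P j) : ℂ) - w (P i) ≠ 0 := by
      rw [← neg_sub]; exact neg_ne_zero.2 hne
    simp only [f, g, Function.comp, map_add, map_one, map_div₀, map_mul, map_sub, Complex.conj_I,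
      Complex.conj_ofReal]
    field_simp
    ring
  rw [h1, pairProd_div, pairProd_sub_perm]
  rcases Int.units_eq_one_or (Perm.sign P) with h | h <;> simp [h, div_neg, neg_div]

/-- The amplitude of a pair of plane waves. -/
noncomputable def waveCoeff {M : ℕ} (c : ℝ) (u v : Fin M → ℝ) (P Q : Perm (Fin M)) : ℂ :=
  ((Perm.sign P : ℤ) : ℂ) * ((Perm.sign Q : ℤ) : ℂ) *
    pairProd (fun x y => y - x + Complex.I * c) ((fun i => (u i : ℂ)) ∘ P) *
    pairProd (fun x y => x - y + Complex.I * c) ((fun i => (v i : ℂ)) ∘ Q)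

/-- The product of the two Vandermonde denominators. -/
noncomputable def vandermondes {M : ℕ} (u v : Fin M → ℝ) : ℂ :=
  pairProd (fun x y => y - x) (fun i => (u i : ℂ)) *
    pairProd (fun x y => x - y) (fun i => (v i : ℂ))

theorem conj_betheSum_mul_betheSum {M : ℕ} (c : ℝ) {u v : Fin M → ℝ} (hu : Function.Injective u)
    (hv : Function.Injective v) (x : Fin M → ℝ) :
    (starRingEnd ℂ) (betheSum c u x) * betheSum c v x = (vandermondes u v)⁻¹ *
      ∑ P : Perm (Fin M), ∑ Q : Perm (Fin M), waveCoeff c u v P Q *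
        Complex.exp (Complex.I * ∑ i, ((v (Q i) : ℂ) - u (P i)) * x i) := by
  rw [betheSum_eq, betheSum_eq, map_sum, sum_mul_sum, mul_sum univ _ (vandermondes u v)⁻¹]
  refine sum_congr rfl fun P _ => ?_
  rw [mul_sum univ _ (vandermondes u v)⁻¹]
  refine sum_congr rfl fun Q _ => ?_
  have he : Complex.exp (Complex.I * ∑ i, ((v (Q i) : ℂ) - u (P i)) * x i) =
      (starRingEnd ℂ) (Complex.exp (Complex.I * ∑ i, (u (P i) : ℂ) * x i)) *
        Complex.exp (Complex.I * ∑ i, (v (Q i) : ℂ) * x i) := by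
    rw [← Complex.exp_conj, ← Complex.exp_add]
    congr 1
    simp only [map_mul, map_sum, Complex.conj_I, Complex.conj_ofReal, sub_mul, sum_sub_distrib]
    ring
  rw [he, map_mul, conj_F_comp_perm c hu, F_comp_perm c hv, waveCoeff, vandermondes, mul_inv]
  ring

/-- On a sector with fixed signs the convergence factor is a plane wave with imaginary momentum: it
shifts the `v i` by `∓iε`. -/
theorem mepnoIntegrand_eq {n m : ℕ} {c : ℝ} (hc : c ≠ 0) (κ : ℂ) {u v : Fin (n + m) → ℝ}
    (hu : Function.Injective u) (hv : Function.Injective v) (ε : ℝ) {x : Fin (n + m) → ℝ}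
    (hx : x ∈ twoSector n m) :
    mepnoIntegrand c κ u v ε x = (c : ℂ) ^ (n + m) * κ ^ n * (vandermondes u v)⁻¹ *
      ∑ P : Perm (Fin (n + m)), ∑ Q : Perm (Fin (n + m)), waveCoeff c u v P Q *
        (Complex.exp (∑ i, (-Complex.I * ((u (P (Fin.castAdd m i)) : ℂ) -
          ((v (Q (Fin.castAdd m i)) : ℂ) + -(Complex.I * ε)))) * x (Fin.castAdd m i)) *
        Complex.exp (-∑ i, (-Complex.I * ((v (Q (Fin.natAdd n i)) : ℂ) + Complex.I * ε -
          (u (P (Fin.natAdd n i)) : ℂ))) * x (Fin.natAdd n i))) := by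
  have hneg : ∀ i, x (Fin.castAdd m i) < 0 := hx.1.1
  have hpos : ∀ i, 0 < x (Fin.natAdd n i) := hx.2.1
  have hκ : ∏ i, κ ^ heaviside (-(x i)) = κ ^ n := by
    rw [Fin.prod_univ_add]
    simp [heaviside, hneg, fun i => (hpos i).not_gt]
  have habs : ∑ i, |x i| = -(∑ i, x (Fin.castAdd m i)) + ∑ i, x (Fin.natAdd n i) := by
    rw [Fin.sum_univ_add, ← sum_neg_distrib]
    simp [fun i => abs_of_neg (hneg i), fun i => abs_of_pos (hpos i)]
  have h1 : mepnoIntegrand c κ u v ε x = (Real.exp (-ε * ∑ i, |x i|) : ℂ) *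
      ((c : ℂ) ^ (n + m) * κ ^ n * ((starRingEnd ℂ) (betheSum c u x) * betheSum c v x)) := by
    rw [mepnoIntegrand, numberOp, hκ, betheBra, betheKet, ← normConst_mul_self hc]
    ring
  rw [h1, conj_betheSum_mul_betheSum c hu hv, mul_left_comm, mul_assoc _ (vandermondes u v)⁻¹]
  congr 1
  rw [mul_left_comm]
  congr 1
  rw [mul_sum]
  refine sum_congr rfl fun P _ => ?_
  rw [mul_sum]
  refine sum_congr rfl fun Q _ => ?_
  rw [mul_left_comm]
  congr 1
  rw [habs, Complex.ofReal_exp, ← Complex.exp_add, ← Complex.exp_add, Fin.sum_univ_add]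
  congr 1
  push_cast
  simp only [mul_add, mul_sum, ← sum_neg_distrib, neg_mul, mul_neg, neg_neg]
  rw [add_add_add_comm, ← sum_add_distrib, ← sum_add_distrib]
  congr 1
  · refine sum_congr rfl fun i _ => ?_
    linear_combination (ε * x (Fin.castAdd m i) : ℂ) * Complex.I_sq
  · refine sum_congr rfl fun i _ => ?_
    linear_combination (-ε * x (Fin.natAdd n i) : ℂ) * Complex.I_sq

/-! ### The limit of vanishing damping -/

theorem mepnoIntegrand_twoSector {n m : ℕ} {c : ℝ} (hc : c ≠ 0) (κ : ℂ) {u v : Fin (n + m) → ℝ}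
    (hu : Function.Injective u) (hv : Function.Injective v) {ε : ℝ} (hε : 0 < ε) :
    IntegrableOn (mepnoIntegrand c κ u v ε) (twoSector n m) ∧
    ∫ x in twoSector n m, mepnoIntegrand c κ u v ε x =
      κ ^ n * ((Complex.I * c) ^ (n + m) * (vandermondes u v)⁻¹ *
        twoSectorSum (n := n) (m := m) (Complex.I * c) (Complex.I * ε) (fun i => (u i : ℂ))
          (fun i => (v i : ℂ))) := by
  have ha : ∀ (P Q : Perm (Fin (n + m))) (i : Fin n), 0 < (-Complex.I *
      ((u (P (Fin.castAdd m i)) : ℂ) - ((v (Q (Fin.castAdd m i)) : ℂ) + -(Complex.I * ε)))).re :=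
    fun P Q i => by simpa using hε
  have hb : ∀ (P Q : Perm (Fin (n + m))) (i : Fin m), 0 < (-Complex.I *
      ((v (Q (Fin.natAdd n i)) : ℂ) + Complex.I * ε - (u (P (Fin.natAdd n i)) : ℂ))).re :=
    fun P Q i => by simpa using hε
  have hint := fun P Q : Perm (Fin (n + m)) => integrableOn_exp_twoSector (ha P Q) (hb P Q)
  have hval := fun P Q : Perm (Fin (n + m)) => integral_exp_twoSector (ha P Q) (hb P Q)
  have hint2 := fun P Q : Perm (Fin (n + m)) => (hint P Q).const_mul (waveCoeff c u v P Q)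
  have hint3 := fun P : Perm (Fin (n + m)) => integrable_finsetSum univ fun Q _ => hint2 P Q
  have hint4 := integrable_finsetSum univ fun P _ => hint3 P
  refine ⟨?_, ?_⟩
  · have h := hint4.const_mul ((c : ℂ) ^ (n + m) * κ ^ n * (vandermondes u v)⁻¹)
    exact IntegrableOn.congr_fun h (fun x hx => (mepnoIntegrand_eq hc κ hu hv ε hx).symm)
      (measurableSet_twoSector n m)
  · rw [setIntegral_congr_fun (measurableSet_twoSector n m)
      (fun x hx => mepnoIntegrand_eq hc κ hu hv ε hx), integral_const_mul,
      integral_finsetSum _ fun P _ => hint3 P, twoSectorSum]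
    have hinv : (-Complex.I)⁻¹ = Complex.I := by
      rw [inv_neg, Complex.inv_I, neg_neg]
    have hterm : ∀ P : Perm (Fin (n + m)), ∫ x in twoSector n m, ∑ Q : Perm (Fin (n + m)),
        waveCoeff c u v P Q *
        (Complex.exp (∑ i, (-Complex.I * ((u (P (Fin.castAdd m i)) : ℂ) -
          ((v (Q (Fin.castAdd m i)) : ℂ) + -(Complex.I * ε)))) * x (Fin.castAdd m i)) *
        Complex.exp (-∑ i, (-Complex.I * ((v (Q (Fin.natAdd n i)) : ℂ) + Complex.I * ε -
          (u (P (Fin.natAdd n i)) : ℂ))) * x (Fin.natAdd n i))) =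
        Complex.I ^ (n + m) * ∑ Q : Perm (Fin (n + m)), waveCoeff c u v P Q *
          (tailProd (fun k : Fin n => (u (P (Fin.castAdd m k.rev)) : ℂ) -
            ((v (Q (Fin.castAdd m k.rev)) : ℂ) + -(Complex.I * ε))) *
          tailProd (fun k : Fin m => (v (Q (Fin.natAdd n k)) : ℂ) + Complex.I * ε -
            (u (P (Fin.natAdd n k)) : ℂ))) := fun P => by
      rw [integral_finsetSum _ fun Q _ => hint2 P Q, mul_sum]
      refine sum_congr rfl fun Q _ => ?_
      rw [integral_const_mul, hval, tailProd_const_mul, tailProd_const_mul, hinv, pow_add]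
      ring
    simp_rw [hterm]
    rw [← mul_sum, mul_pow]
    simp only [waveCoeff, Function.comp_def]
    ring

theorem continuousAt_sectorDet {n : ℕ} {η : ℂ} {U V : ℝ → Fin n → ℂ}
    (hU : ∀ i, ContinuousAt (fun ε => U ε i) 0) (hV : ∀ i, ContinuousAt (fun ε => V ε i) 0)
    (h0 : ∀ i j, V 0 i - U 0 j ≠ 0) (h1 : ∀ i j, V 0 i - U 0 j + η ≠ 0) :
    ContinuousAt (fun ε => sectorDet η (U ε) (V ε)) 0 := by
  have hd : ∀ i j, ContinuousAt (fun ε => V ε i - U ε j) 0 := fun i j => (hV i).sub (hU j)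
  have hd1 : ∀ i j, ContinuousAt (fun ε => V ε i - U ε j + η) 0 := fun i j =>
    (hd i j).add continuousAt_const
  have hm : ContinuousAt (fun ε => Matrix.of fun i j => kern η (V ε i) (U ε j)) 0 :=
    continuousAt_pi.2 fun i => continuousAt_pi.2 fun j =>
      ((hd i j).mul (hd1 i j)).inv₀ (mul_ne_zero (h0 i j) (h1 i j))
  have hdet : ContinuousAt (fun A : Matrix (Fin n) (Fin n) ℂ => A.det)
      (Matrix.of fun i j => kern η (V 0 i) (U 0 j)) := continuous_id.matrix_det.continuousAt
  unfold sectorDet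
  refine ContinuousAt.mul ?_ (ContinuousAt.comp (f := fun ε => Matrix.of fun i j =>
    kern η (V ε i) (U ε j)) hdet hm)
  exact tendsto_finsetProd _ fun i _ => tendsto_finsetProd _ fun j _ => hd1 i j

theorem ofReal_sub_add_ne_zero {x y : ℝ} (h : x ≠ y) (s : ℝ) :
    (x : ℂ) - y + Complex.I * s ≠ 0 := fun h0 => by
  have := congrArg Complex.re h0
  simp at this
  exact h (by linarith)

theorem ofReal_sub_add_ne_zero' (x y : ℝ) {s : ℝ} (hs : s ≠ 0) :
    (x : ℂ) - y + Complex.I * s ≠ 0 := fun h0 => by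
  have := congrArg Complex.im h0
  simp at this
  exact hs this

/-- The limit of vanishing damping of the sector with `n` negative coordinates. The individual
plane waves may diverge; their sum is a product of determinants and has a limit. -/
theorem tendsto_twoSectorSum {n m : ℕ} {c : ℝ} (hc : c ≠ 0) {u v : Fin (n + m) → ℝ}
    (hu : Function.Injective u) (hv : Function.Injective v) (huv : ∀ i j, u i ≠ v j) :
    Tendsto (fun ε : ℝ => twoSectorSum (n := n) (m := m) (Complex.I * c) (Complex.I * ε)
      (fun i => (u i : ℂ)) (fun i => (v i : ℂ))) (𝓝[>] 0)
      (𝓝 (∑ J ∈ powersetCard n univ, subsetTerm (Complex.I * c) (fun i => (u i : ℂ))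
        (fun i => (v i : ℂ)) J)) := by
  set η : ℂ := Complex.I * c with hη
  have hη0 : η ≠ 0 := mul_ne_zero Complex.I_ne_zero (by exact_mod_cast hc)
  have hu' : Function.Injective fun i => (u i : ℂ) := Complex.ofReal_injective.comp hu
  have hv' : Function.Injective fun i => (v i : ℂ) := Complex.ofReal_injective.comp hv
  have hN : (n.factorial * m.factorial : ℂ) ^ 2 ≠ 0 := pow_ne_zero _
    (mul_ne_zero (by exact_mod_cast n.factorial_ne_zero) (by exact_mod_cast m.factorial_ne_zero))
  let G : ℝ → ℂ := fun ε => ∑ P : Perm (Fin (n + m)), ∑ Q : Perm (Fin (n + m)),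
    ((Perm.sign P : ℤ) : ℂ) * ((Perm.sign Q : ℤ) : ℂ) *
      crossProd (n := n) (m := m) η ((fun i => (u i : ℂ)) ∘ P) ((fun i => (v i : ℂ)) ∘ Q) *
      (sectorDet η (fun i => (v (Q (Fin.castAdd m i)) : ℂ) + -(Complex.I * ε))
        (fun i => (u (P (Fin.castAdd m i)) : ℂ)) *
      sectorDet η (fun i => (u (P (Fin.natAdd n i)) : ℂ))
        (fun i => (v (Q (Fin.natAdd n i)) : ℂ) + Complex.I * ε))
  have hG : ContinuousAt G 0 := by
    refine tendsto_finsetSum _ fun P _ => tendsto_finsetSum _ fun Q _ => ?_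
    refine ContinuousAt.mul continuousAt_const (ContinuousAt.mul ?_ ?_)
    · refine continuousAt_sectorDet (U := fun ε i => (v (Q (Fin.castAdd m i)) : ℂ) +
        -(Complex.I * ε)) (V := fun _ i => (u (P (Fin.castAdd m i)) : ℂ))
        (fun i => by fun_prop) (fun i => by fun_prop) (fun i j => ?_) (fun i j => ?_)
      · simpa using ofReal_sub_add_ne_zero (huv (P (Fin.castAdd m i)) (Q (Fin.castAdd m j))) 0
      · simpa using ofReal_sub_add_ne_zero (huv (P (Fin.castAdd m i)) (Q (Fin.castAdd m j))) c
    · refine continuousAt_sectorDet (U := fun _ i => (u (P (Fin.natAdd n i)) : ℂ))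
        (V := fun ε i => (v (Q (Fin.natAdd n i)) : ℂ) + Complex.I * ε)
        (fun i => by fun_prop) (fun i => by fun_prop) (fun i j => ?_) (fun i j => ?_)
      · simpa using ofReal_sub_add_ne_zero (huv (P (Fin.natAdd n j)) (Q (Fin.natAdd n i))).symm 0
      · simpa using ofReal_sub_add_ne_zero (huv (P (Fin.natAdd n j)) (Q (Fin.natAdd n i))).symm c
  have hG0 : G 0 = (n.factorial * m.factorial : ℂ) ^ 2 * ∑ J ∈ powersetCard n univ,
      subsetTerm η (fun i => (u i : ℂ)) (fun i => (v i : ℂ)) J := by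
    rw [← sum_sum_sectorDet_eq (η := η) hu' hv'
      (fun i j => by simpa using ofReal_sub_add_ne_zero (huv i j) 0)
      (fun i j => ofReal_sub_add_ne_zero (huv i j) c)
      (fun i j => ofReal_sub_add_ne_zero (huv j i).symm c)
      (fun i j => ofReal_sub_add_ne_zero' _ _ hc)]
    simp [G]
  have hpos : ∀ ε : ℝ, 0 < ε → twoSectorSum (n := n) (m := m) η (Complex.I * ε)
      (fun i => (u i : ℂ)) (fun i => (v i : ℂ)) =
        ((n.factorial * m.factorial : ℂ) ^ 2)⁻¹ * G ε := fun ε hε => by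
    rw [eq_inv_mul_iff_mul_eq₀ hN, twoSectorSum_eq]
    refine sum_congr rfl fun P _ => sum_congr rfl fun Q _ => ?_
    rw [sectorSum_eq hη0 (u := fun i => (v (Q (Fin.castAdd m i)) : ℂ) + -(Complex.I * ε)),
      sectorSum_eq hη0 (u := fun i => (u (P (Fin.natAdd n i)) : ℂ))]
    · rfl
    · exact hu'.comp (P.injective.comp (Fin.natAdd_injective m n))
    · exact (add_left_injective _).comp (hv'.comp (Q.injective.comp (Fin.natAdd_injective m n)))
    · intro i j; simpa using hε
    · intro i j
      have := ofReal_sub_add_ne_zero (huv (P (Fin.natAdd n j)) (Q (Fin.natAdd n i))).symm (ε + c)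
      convert this using 1
      rw [hη]; push_cast; ring
    · exact (add_left_injective _).comp (hv'.comp (Q.injective.comp (Fin.castAdd_injective n m)))
    · exact hu'.comp (P.injective.comp (Fin.castAdd_injective n m))
    · intro i j; simpa using hε
    · intro i j
      have := ofReal_sub_add_ne_zero (huv (P (Fin.castAdd m i)) (Q (Fin.castAdd m j))) (ε + c)
      convert this using 1
      rw [hη]; push_cast; ring
  have hlim := (hG.tendsto.mono_left (nhdsWithin_le_nhds (s := Set.Ioi 0))).const_mul
    ((n.factorial * m.factorial : ℂ) ^ 2)⁻¹
  rw [hG0, inv_mul_cancel_left₀ hN] at hlim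
  refine hlim.congr' ?_
  filter_upwards [self_mem_nhdsWithin] with ε hε
  exact (hpos ε hε).symm

/-- The contribution of the configurations with `n` negative coordinates. -/
theorem mepnoIntegrand_signSector {M n : ℕ} (hn : n ≤ M) {c : ℝ} (hc : c ≠ 0) (κ : ℂ)
    {u v : Fin M → ℝ} (hu : Function.Injective u) (hv : Function.Injective v)
    (huv : ∀ i j, u i ≠ v j) :
    (∀ ε : ℝ, 0 < ε → IntegrableOn (mepnoIntegrand c κ u v ε) (signSector M n)) ∧
    Tendsto (fun ε : ℝ => ∫ x in signSector M n, mepnoIntegrand c κ u v ε x) (𝓝[>] 0)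
      (𝓝 (κ ^ n * ((Complex.I * c) ^ M * (vandermondes u v)⁻¹ * ∑ J ∈ powersetCard n univ,
        subsetTerm (Complex.I * c) (fun i => (u i : ℂ)) (fun i => (v i : ℂ)) J))) := by
  obtain ⟨m, rfl⟩ := Nat.exists_eq_add_of_le hn
  rw [signSector_add]
  refine ⟨fun ε hε => (mepnoIntegrand_twoSector hc κ hu hv hε).1, ?_⟩
  refine (((tendsto_twoSectorSum hc hu hv huv).const_mul _).const_mul _).congr' ?_
  filter_upwards [self_mem_nhdsWithin] with ε hε
  exact (mepnoIntegrand_twoSector hc κ hu hv hε).2.symm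

/-- The matrix element as a sum over the subsets of the `v i` on the negative half-line. -/
theorem hasMatrixElement_sum {M : ℕ} {c : ℝ} (hc : c ≠ 0) (κ : ℂ) {u v : Fin M → ℝ}
    (hu : Function.Injective u) (hv : Function.Injective v) (huv : ∀ i j, u i ≠ v j) :
    HasMatrixElement c κ u v ((Complex.I * c) ^ M * (vandermondes u v)⁻¹ *
      ∑ n ∈ range (M + 1), κ ^ n * ∑ J ∈ powersetCard n univ,
        subsetTerm (Complex.I * c) (fun i => (u i : ℂ)) (fun i => (v i : ℂ)) J) := by
  have hs := fun n (hn : n ∈ range (M + 1)) =>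
    mepnoIntegrand_signSector (Nat.lt_succ_iff.1 (mem_range.1 hn)) hc κ hu hv huv
  refine ⟨fun ε hε => ?_, ?_⟩
  · refine IntegrableOn.congr_set_ae ?_ (D_ae_eq_iUnion_signSector M)
    exact (integrableOn_finset_iUnion).2 fun n hn => (hs n hn).1 ε hε
  · rw [mul_sum]
    have hlim := tendsto_finsetSum (range (M + 1)) fun n hn => (hs n hn).2
    have he : ∑ n ∈ range (M + 1), κ ^ n * ((Complex.I * c) ^ M * (vandermondes u v)⁻¹ *
        ∑ J ∈ powersetCard n univ,
          subsetTerm (Complex.I * c) (fun i => (u i : ℂ)) (fun i => (v i : ℂ)) J) =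
        ∑ n ∈ range (M + 1), (Complex.I * c) ^ M * (vandermondes u v)⁻¹ *
        (κ ^ n * ∑ J ∈ powersetCard n univ,
          subsetTerm (Complex.I * c) (fun i => (u i : ℂ)) (fun i => (v i : ℂ)) J) :=
      sum_congr rfl fun n _ => by ring
    rw [he] at hlim
    refine hlim.congr' ?_
    filter_upwards [self_mem_nhdsWithin] with ε hε
    rw [setIntegral_congr_set (D_ae_eq_iUnion_signSector M), integral_biUnion_finset _
      (fun n _ => measurableSet_signSector M n) (pairwiseDisjoint_signSector M)
      (fun n hn => (hs n hn).1 ε hε)]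

theorem det_cauchyMatrix {M : ℕ} {c : ℝ} {u v : Fin M → ℝ}
    (hv : Function.Injective v) (huv : ∀ i j, u i ≠ v j) :
    (cauchyMatrix c u v).det * ∏ i, ∏ j, ((u i : ℂ) - v j + Complex.I * c) =
      (Complex.I * c) ^ M * vandermondes u v := by
  have hdet := det_cauchy (fun i => (u i : ℂ) + Complex.I * c) (fun i => (v i : ℂ))
    (Complex.ofReal_injective.comp hv) fun i j => by
      rw [add_sub_right_comm]
      exact ofReal_sub_add_ne_zero (huv i j) c
  have hm : cauchyMatrix c u v = (Complex.I * (c : ℂ)) •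
      Matrix.of fun i j => ((u i : ℂ) + Complex.I * c - v j)⁻¹ := by
    ext i j
    rw [cauchyMatrix, Matrix.of_apply, h, inv_div, Matrix.smul_apply, Matrix.of_apply, smul_eq_mul,
      add_sub_right_comm, div_eq_mul_inv]
  have hp : pairProd (fun a b => b - a) (fun i => (u i : ℂ) + Complex.I * c) =
      pairProd (fun a b => b - a) (fun i => (u i : ℂ)) := by
    unfold pairProd
    simp only [add_sub_add_right_eq_sub]
  rw [hp] at hdet
  simp only [add_sub_right_comm] at hdet hm
  rw [hm, Matrix.det_smul, Fintype.card_fin, mul_assoc, hdet, vandermondes]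

theorem t_eq (c : ℝ) (x y : ℂ) :
    t c x y = (Complex.I * c) ^ 2 / ((x - y) * (x - y + Complex.I * c)) := by
  rw [t, g, h, div_div_div_eq, sq]

theorem det_slavnovMatrix {M : ℕ} {c : ℝ} (hc : c ≠ 0) (κ : ℂ) (u v : Fin M → ℝ) :
    (slavnovMatrix c κ u v).det = (Complex.I * c) ^ M * ((Complex.I * c) ^ M *
      (Matrix.of fun i j => kern (Complex.I * c) (v i) (u j) *
        ((∏ k, ((v i : ℂ) - u k + Complex.I * c) / ((u k : ℂ) - v i + Complex.I * c)) *
        ∏ k, ((v k : ℂ) - v i + Complex.I * c) / ((v i : ℂ) - v k + Complex.I * c)) +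
        κ * kern (Complex.I * c) (u j) (v i)).det) := by
  have hη : Complex.I * (c : ℂ) ≠ 0 := mul_ne_zero Complex.I_ne_zero (by exact_mod_cast hc)
  have hh : ∀ x y z w : ℂ, h c x y / h c z w = (x - y + Complex.I * c) / (z - w + Complex.I * c) :=
    fun x y z w => div_div_div_cancel_right₀ hη _ _
  rw [← mul_assoc, ← mul_pow, ← sq]
  have hd := Matrix.det_smul (Matrix.of fun i j : Fin M => kern (Complex.I * c) (v i) (u j) *
        ((∏ k, ((v i : ℂ) - u k + Complex.I * c) / ((u k : ℂ) - v i + Complex.I * c)) *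
        ∏ k, ((v k : ℂ) - v i + Complex.I * c) / ((v i : ℂ) - v k + Complex.I * c)) +
        κ * kern (Complex.I * c) (u j) (v i)) ((Complex.I * (c : ℂ)) ^ 2)
  rw [Fintype.card_fin] at hd
  rw [← hd]
  congr 1
  ext i j
  rw [slavnovMatrix, Matrix.of_apply, Matrix.smul_apply, Matrix.of_apply, smul_eq_mul,
    ← prod_div_distrib, ← prod_div_distrib]
  simp only [hh, t_eq, kern, div_eq_mul_inv]
  ring

theorem cauchyMatrix_eq {M : ℕ} (c : ℝ) (u v : Fin M → ℝ) :
    cauchyMatrix c u v = Matrix.of fun i j : Fin M =>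
      Complex.I * (c : ℂ) / ((u i : ℂ) - v j + Complex.I * c) := by
  ext i j
  rw [cauchyMatrix, Matrix.of_apply, h, inv_div, Matrix.of_apply]

theorem slavnovMatrix_eq {M : ℕ} {c : ℝ} (hc : c ≠ 0) (κ : ℂ) (u v : Fin M → ℝ) :
    slavnovMatrix c κ u v = Matrix.of fun i j : Fin M =>
      (Complex.I * (c : ℂ)) ^ 2 /
          (((v i : ℂ) - u j) * ((v i : ℂ) - u j + Complex.I * c))
        * (∏ k, ((v i : ℂ) - u k + Complex.I * c) / ((v i : ℂ) - u k - Complex.I * c))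
        * (∏ k, ((v i : ℂ) - v k - Complex.I * c) / ((v i : ℂ) - v k + Complex.I * c))
      + κ * ((Complex.I * (c : ℂ)) ^ 2 /
          (((v i : ℂ) - u j) * ((v i : ℂ) - u j - Complex.I * c))) := by
  have hη : Complex.I * (c : ℂ) ≠ 0 := mul_ne_zero Complex.I_ne_zero (by exact_mod_cast hc)
  have hh : ∀ x y z w : ℂ, h c x y / h c z w = (x - y + Complex.I * c) / (z - w + Complex.I * c) :=
    fun x y z w => div_div_div_cancel_right₀ hη _ _
  ext i j
  rw [slavnovMatrix, Matrix.of_apply, Matrix.of_apply, ← prod_div_distrib, ← prod_div_distrib,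
    t_eq, t_eq]
  simp only [hh]
  have e1 : ∏ k, ((v i : ℂ) - u k + Complex.I * c) / ((u k : ℂ) - v i + Complex.I * c) =
      (-1) ^ M * ∏ k, ((v i : ℂ) - u k + Complex.I * c) / ((v i : ℂ) - u k - Complex.I * c) := by
    rw [← Fin.prod_const, ← prod_mul_distrib]
    refine prod_congr rfl fun k _ => ?_
    rw [show (u k : ℂ) - v i + Complex.I * c = -((v i : ℂ) - u k - Complex.I * c) by ring, div_neg]
    ring
  have e2 : ∏ k, ((v k : ℂ) - v i + Complex.I * c) / ((v i : ℂ) - v k + Complex.I * c) =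
      (-1) ^ M * ∏ k, ((v i : ℂ) - v k - Complex.I * c) / ((v i : ℂ) - v k + Complex.I * c) := by
    rw [← Fin.prod_const, ← prod_mul_distrib]
    refine prod_congr rfl fun k _ => ?_
    rw [show (v k : ℂ) - v i + Complex.I * c = -((v i : ℂ) - v k - Complex.I * c) by ring, neg_div]
    ring
  have e3 : ((u j : ℂ) - v i) * ((u j : ℂ) - v i + Complex.I * c) =
      ((v i : ℂ) - u j) * ((v i : ℂ) - u j - Complex.I * c) := by ring
  have e4 : ((-1 : ℂ) ^ M) * (-1) ^ M = 1 := by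
    rw [← mul_pow]; simp
  rw [e1, e2, e3]
  congr 1
  linear_combination ((Complex.I * (c : ℂ)) ^ 2 /
    (((v i : ℂ) - u j) * ((v i : ℂ) - u j + Complex.I * c))
    * (∏ k, ((v i : ℂ) - u k + Complex.I * c) / ((v i : ℂ) - u k - Complex.I * c))
    * (∏ k, ((v i : ℂ) - v k - Complex.I * c) / ((v i : ℂ) - v k + Complex.I * c))) * e4

end DeltaBose

theorem mainTheorem1 (M : ℕ) (c : ℝ) (hc : c ≠ 0) (κ : ℂ) (u v : Fin M → ℝ)
    (hu : Function.Injective u) (hv : Function.Injective v) (huv : ∀ i j, u i ≠ v j) :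
    (DeltaBose.cauchyMatrix c u v).det ≠ 0 ∧
    DeltaBose.HasMatrixElement c κ u v
      ((DeltaBose.cauchyMatrix c u v).det⁻¹ * (DeltaBose.slavnovMatrix c κ u v).det) ∧
    (DeltaBose.cauchyMatrix c u v).det⁻¹ * (DeltaBose.slavnovMatrix c κ u v).det =
      (Matrix.det (Matrix.of fun i j : Fin M =>
          Complex.I * (c : ℂ) / ((u i : ℂ) - v j + Complex.I * c)))⁻¹ *
      Matrix.det (Matrix.of fun i j : Fin M =>
          (Complex.I * (c : ℂ)) ^ 2 /
              (((v i : ℂ) - u j) * ((v i : ℂ) - u j + Complex.I * c))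
            * (∏ k, ((v i : ℂ) - u k + Complex.I * c) / ((v i : ℂ) - u k - Complex.I * c))
            * (∏ k, ((v i : ℂ) - v k - Complex.I * c) / ((v i : ℂ) - v k + Complex.I * c))
          + κ * ((Complex.I * (c : ℂ)) ^ 2 /
              (((v i : ℂ) - u j) * ((v i : ℂ) - u j - Complex.I * c)))) := by
  have hη : Complex.I * (c : ℂ) ≠ 0 := mul_ne_zero Complex.I_ne_zero (by exact_mod_cast hc)
  have hV : DeltaBose.vandermondes u v ≠ 0 := mul_ne_zero
    (DeltaBose.pairProd_sub_ne_zero (Complex.ofReal_injective.comp hu))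
    (DeltaBose.pairProd_sub_rev_ne_zero (Complex.ofReal_injective.comp hv))
  have hC := DeltaBose.det_cauchyMatrix (c := c) hv huv
  have hC0 : (DeltaBose.cauchyMatrix c u v).det ≠ 0 := fun h0 => by
    rw [h0, zero_mul] at hC
    exact mul_ne_zero (pow_ne_zero M hη) hV hC.symm
  refine ⟨hC0, ?_, ?_⟩
  · have h := DeltaBose.hasMatrixElement_sum hc κ hu hv huv
    rw [DeltaBose.sum_pow_mul_subsetTerm κ
      (fun i j => DeltaBose.ofReal_sub_add_ne_zero (huv i j) c)
      (fun i j => DeltaBose.ofReal_sub_add_ne_zero' _ _ hc)] at h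
    convert h using 1
    rw [DeltaBose.det_slavnovMatrix hc, inv_mul_eq_iff_eq_mul₀ hC0]
    have hV' := mul_inv_cancel₀ hV
    set N := (Matrix.of fun i j => DeltaBose.kern (Complex.I * c) (v i) (u j) *
        ((∏ k, ((v i : ℂ) - u k + Complex.I * c) / ((u k : ℂ) - v i + Complex.I * c)) *
        ∏ k, ((v k : ℂ) - v i + Complex.I * c) / ((v i : ℂ) - v k + Complex.I * c)) +
        κ * DeltaBose.kern (Complex.I * c) (u j) (v i)).det
    linear_combination (-(Complex.I * (c : ℂ)) ^ M * (DeltaBose.vandermondes u v)⁻¹ * N) * hC -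
      ((Complex.I * (c : ℂ)) ^ M * (Complex.I * (c : ℂ)) ^ M * N) * hV'
  · rw [DeltaBose.slavnovMatrix_eq hc, DeltaBose.cauchyMatrix_eq]
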